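/- Let $(S,T)$ be a closed connected triangulated surface with vertex set $V$ and edge set $E$. Here a triangulated surface is a surface obtained from a finite disjoint union of triangles by identifying their sides in pairs (simplicial triangulations are a special case; the vertices of a triangle need not be distinct in $S$). Let $I\in\mathbb R_{\ge 0}^{E}$. For a radius vector $r\in\mathbb R_{>0}^{V}$ define edge lengths by $$l_r(e)=\sqrt{r(u)^2+r(v)^2+2\,r(u)\,r(v)\,I(e)}\quad\text{(Euclidean case)},$$ $$l_r(e)=\cosh^{-1}\bigl(\cosh r(u)\cosh r(v)+I(e)\sinh r(u)\sinh r(v)\bigr)\quad\text{(hyperbolic case)},$$ where $u,v$ are the end points of the edge $e$. If $l_r(e_i)+l_r(e_j)>l_r(e_k)$ for the three sides $e_i,e_j,e_k$, in any order, of every triangle of $T$, then $l_r$ is called the Euclidean (respectively hyperbolic) inversive distance circle packing metric with inversive distance $I$ and radius vector $r$. Each triangle of $T$ is then realized as a Euclidean (respectively hyperbolic, of curvature $-1$) triangle with the side lengths given by $l_r$, and the discrete curvature of the metric is the function $k_r:V\to\mathbb R$, $k_r(v)=2\pi-\sum_i\theta_i$, where the $\theta_i$ are the inner angles of the triangles at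 all corners lying at the vertex $v$. (1) If $r$ and $r'$ are the radius vectors of two hyperbolic inversive distance circle packing metrics on $(S,T)$ with the same inversive distance $I$, and $k_r=k_{r'}$, then $r=r'$, and hence $l_r=l_{r'}$. (2) If $r$ and $r'$ are the radius vectors of two Euclidean inversive distance circle packing metrics on $(S,T)$ with the same inversive distance $I$, and $k_r=k_{r'}$, then there is a constant $c>0$ with $r'=c\,r$, and hence $l_{r'}=c\,l_r$. -/

import Mathlib

/-- A directed side of one of the triangles indexed by `F`.  The corners of the triangle `f` are
`(f, 0)`, `(f, 1)`, `(f, 2)`; the directed side `⟨f, a, b, _⟩` runs from the corner `(f, a)` to the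
corner `(f, b)`. -/
@[ext]
structure DirectedSide (F : Type*) where
  face : F
  src : Fin 3
  tgt : Fin 3
  src_ne_tgt : src ≠ tgt

/-- The same side with the opposite direction. -/
def DirectedSide.rev {F : Type*} (d : DirectedSide F) : DirectedSide F :=
  ⟨d.face, d.tgt, d.src, d.src_ne_tgt.symm⟩

/-- A triangulation of a closed (possibly disconnected, possibly non-orientable) surface whose
triangles are indexed by the (finite) type `F`: the disjoint union of the triangles with their sides
identified in pairs.  The side `d` is identified with the side `glue d`, the source of `d`
going to the source of `glue d` and the target to the target.  The last two axioms say
that a side is never identified with itself, so that each edge has exactly two sides.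
(The quotient space is automatically a closed surface.  Every simplicial complex that triangulates
a closed surface arises in this way, but two vertices of a triangle, or two of its sides,
may also become equal in the quotient.) -/
structure SurfaceTriangulation (F : Type*) where
  glue : DirectedSide F → DirectedSide F
  glue_glue : ∀ d, glue (glue d) = d
  glue_rev : ∀ d, glue d.rev = (glue d).rev
  glue_ne : ∀ d, glue d ≠ d
  glue_ne_rev : ∀ d, glue d ≠ d.rev

namespace SurfaceTriangulation

/-- The vertices: corners of triangles, identified by the gluing. -/
def Vertex {F : Type*} (T : SurfaceTriangulation F) : Type _ :=
  Quot fun c c' : F × Fin 3 =>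
    ∃ d : DirectedSide F, c = (d.face, d.src) ∧ c' = ((T.glue d).face, (T.glue d).src)

/-- The (undirected) edges: directed sides of triangles, identified by the gluing and by
reversal of direction. -/
def Edge {F : Type*} (T : SurfaceTriangulation F) : Type _ :=
  Quot fun d d' : DirectedSide F => d' = d.rev ∨ d' = T.glue d

/-- The vertex of the triangulation at a corner of a triangle. -/
def vertex {F : Type*} (T : SurfaceTriangulation F) (c : F × Fin 3) : T.Vertex :=
  Quot.mk _ c

/-- The edge of the triangulation containing a side of a triangle. -/
def edge {F : Type*} (T : SurfaceTriangulation F) (d : DirectedSide F) : T.Edge :=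
  Quot.mk _ d

theorem vertex_src_glue {F : Type*} (T : SurfaceTriangulation F) (d : DirectedSide F) :
    T.vertex ((T.glue d).face, (T.glue d).src) = T.vertex (d.face, d.src) :=
  (Quot.sound ⟨d, rfl, rfl⟩).symm

theorem vertex_tgt_glue {F : Type*} (T : SurfaceTriangulation F) (d : DirectedSide F) :
    T.vertex ((T.glue d).face, (T.glue d).tgt) = T.vertex (d.face, d.tgt) := by
  have h := T.vertex_src_glue d.rev
  rw [T.glue_rev] at h
  exact h

/-- The unordered pair of end points of an edge. -/
def endpoints {F : Type*} (T : SurfaceTriangulation F) : T.Edge → Sym2 T.Vertex :=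
  Quot.lift (fun d => s(T.vertex (d.face, d.src), T.vertex (d.face, d.tgt))) (by
    rintro d d' (rfl | rfl)
    · exact Sym2.eq_swap
    · simp only [vertex_src_glue, vertex_tgt_glue])

/-- The edge opposite to the corner `(f, i)` in the triangle `f`. -/
def oppositeEdge {F : Type*} (T : SurfaceTriangulation F) (f : F) (i : Fin 3) : T.Edge :=
  T.edge ⟨f, i + 1, i + 2, by revert i; decide⟩

/-- The surface is connected: it is non-empty and any two triangles are joined by a chain of
triangles in which consecutive ones share an edge. -/
def IsConnected {F : Type*} (T : SurfaceTriangulation F) : Prop :=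
  Nonempty F ∧ ∀ f g : F,
    Relation.ReflTransGen (fun f₁ f₂ => ∃ d, d.face = f₁ ∧ (T.glue d).face = f₂) f g

/-- An edge length function is a (Euclidean or hyperbolic) polyhedral metric if the strict
triangle inequalities hold in every triangle. -/
def IsPolyhedralMetric {F : Type*} (T : SurfaceTriangulation F) (l : T.Edge → ℝ) : Prop :=
  ∀ (f : F) (i j k : Fin 3), i ≠ j → j ≠ k → k ≠ i →
    l (T.oppositeEdge f k) < l (T.oppositeEdge f i) + l (T.oppositeEdge f j)

end SurfaceTriangulation

/-- The inner angle opposite to the side of length `a` in the Euclidean triangle with side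
lengths `a`, `b`, `c`, by the cosine law. -/
noncomputable def euclideanTriangleAngle (a b c : ℝ) : ℝ :=
  Real.arccos ((b ^ 2 + c ^ 2 - a ^ 2) / (2 * b * c))

/-- The inner angle opposite to the side of length `a` in the hyperbolic triangle with side
lengths `a`, `b`, `c` (curvature `-1`), by the hyperbolic cosine law. -/
noncomputable def hyperbolicTriangleAngle (a b c : ℝ) : ℝ :=
  Real.arccos
    ((Real.cosh b * Real.cosh c - Real.cosh a) / (Real.sinh b * Real.sinh c))

namespace SurfaceTriangulation

open Classical in
/-- The discrete curvature `2π - ∑ θ` at a vertex, the sum being over all the corners of triangles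
at that vertex; `angle a b c` is the angle facing the side of length `a`
in a triangle with side lengths `a`, `b`, `c` in the geometry at hand. -/
noncomputable def curvature {F : Type*} [Fintype F] (T : SurfaceTriangulation F)
    (angle : ℝ → ℝ → ℝ → ℝ) (l : T.Edge → ℝ) (v : T.Vertex) : ℝ :=
  2 * Real.pi - ∑ c : F × Fin 3 with T.vertex c = v,
    angle (l (T.oppositeEdge c.1 c.2)) (l (T.oppositeEdge c.1 (c.2 + 1)))
      (l (T.oppositeEdge c.1 (c.2 + 2)))

/-- Discrete curvature of a Euclidean polyhedral metric. -/
noncomputable def euclideanCurvature {F : Type*} [Fintype F] (T : SurfaceTriangulation F)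
    (l : T.Edge → ℝ) : T.Vertex → ℝ :=
  T.curvature euclideanTriangleAngle l

/-- Discrete curvature of a hyperbolic polyhedral metric. -/
noncomputable def hyperbolicCurvature {F : Type*} [Fintype F] (T : SurfaceTriangulation F)
    (l : T.Edge → ℝ) : T.Vertex → ℝ :=
  T.curvature hyperbolicTriangleAngle l

/-- The Euclidean edge length function of the radius vector `r` and the inversive distances `I`. -/
noncomputable def euclideanLength {F : Type*} (T : SurfaceTriangulation F)
    (I : T.Edge → ℝ) (r : T.Vertex → ℝ) (e : T.Edge) : ℝ :=
  Sym2.lift ⟨fun u v => Real.sqrt (r u ^ 2 + r v ^ 2 + 2 * r u * r v * I e),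
    fun u v => by ring_nf⟩ (T.endpoints e)

/-- The hyperbolic edge length function of the radius vector `r` and the inversive distances
`I`. -/
noncomputable def hyperbolicLength {F : Type*} (T : SurfaceTriangulation F)
    (I : T.Edge → ℝ) (r : T.Vertex → ℝ) (e : T.Edge) : ℝ :=
  Sym2.lift ⟨fun u v => Real.arcosh
      (Real.cosh (r u) * Real.cosh (r v) + I e * Real.sinh (r u) * Real.sinh (r v)),
    fun u v => by ring_nf⟩ (T.endpoints e)

/-- The radius vector `r` defines a Euclidean inversive distance circle packing metric with
inversive distances `I`. -/
def IsEuclideanCirclePacking {F : Type*} (T : SurfaceTriangulation F)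
    (I : T.Edge → ℝ) (r : T.Vertex → ℝ) : Prop :=
  (∀ v, 0 < r v) ∧ T.IsPolyhedralMetric (T.euclideanLength I r)

/-- The radius vector `r` defines a hyperbolic inversive distance circle packing metric with
inversive distances `I`. -/
def IsHyperbolicCirclePacking {F : Type*} (T : SurfaceTriangulation F)
    (I : T.Edge → ℝ) (r : T.Vertex → ℝ) : Prop :=
  (∀ v, 0 < r v) ∧ T.IsPolyhedralMetric (T.hyperbolicLength I r)

end SurfaceTriangulation

/-! The proof is a variational argument phrased through the angles, the gradient of the energy. In
the conformal factor `u` with `du = dr / S` (`u = log r` with `S = r`, or `u = log (tanh (r / 2))`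
with `S = sinh r`), the Jacobian of the three angles of a nondegenerate triangle is symmetric and
negative semidefinite (`form_nonneg`). It is definite in the hyperbolic case
(`eq_zero_of_form_eq_zero`), and its kernel consists of constant vectors in the Euclidean case
(`eq_of_form_eq_zero`). A parameter `ε`, equal to `1` or `0`, lets the same polynomial identities
serve both geometries.

The obstacle is that a segment of conformal factors joining two packings may cross radii that
violate a triangle inequality. There each angle, extended by the clamping of `arccos`, is `0` or
`π`, so the sum of the `w i * θ i`, with `w` the direction of the segment, lies in a finite set. A
continuous function whose derivative is nonpositive away from finitely many values cannot increase
(`le_of_deriv_nonpos_off_finite`); hence this sum is nonincreasing along the whole segment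
(`sum_angle_le`).

Equal curvatures make the sums over all triangles agree at both ends
(`sum_mul_angle_eq_of_curvature_eq`). By monotonicity they agree triangle by triangle, and the
derivative at the first packing vanishes (`form_eq_zero_of_sum_angle_eq`). So `w = 0` in the
hyperbolic case. In the Euclidean case `w` is constant on each triangle, hence on the connected
surface, which is a scaling. -/

namespace InversiveTriangle

/-! ### Polynomial data of one triangle, in both geometries -/

/-- `cosh` of the side opposite to the corner `i`. The parameter `ε` is minus the curvature; `C` and
`S` are the (generalized) hyperbolic cosines and sines of the radii. -/
def coshSide (ε : ℝ) (C S I : Fin 3 → ℝ) (i : Fin 3) : ℝ :=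
  C (i + 1) * C (i + 2) + ε * I i * S (i + 1) * S (i + 2)

/-- `sinh ^ 2` of the side opposite to the corner `i`. -/
def sinhSqSide (ε : ℝ) (C S I : Fin 3 → ℝ) (i : Fin 3) : ℝ :=
  S (i + 1) ^ 2 + S (i + 2) ^ 2 + 2 * I i * C (i + 1) * C (i + 2) * S (i + 1) * S (i + 2)
    + ε * (1 + I i ^ 2) * S (i + 1) ^ 2 * S (i + 2) ^ 2

/-- The cosine of the angle at the corner `i`, times the `sinh` of the two adjacent sides. -/
def cosNum (ε : ℝ) (C S I : Fin 3 → ℝ) (i : Fin 3) : ℝ :=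
  S i ^ 2 * C (i + 1) * C (i + 2) + I (i + 2) * C i * C (i + 2) * S i * S (i + 1)
    + I (i + 1) * C i * C (i + 1) * S i * S (i + 2)
    + (ε * I (i + 1) * I (i + 2) * S i ^ 2 - I i) * S (i + 1) * S (i + 2)

/-- The square of the sine of any angle times the `sinh` of the two adjacent sides; positive
exactly when the triangle is nondegenerate. -/
def areaSq (ε : ℝ) (C S I : Fin 3 → ℝ) : ℝ :=
  sinhSqSide ε C S I 1 * sinhSqSide ε C S I 2 - cosNum ε C S I 0 ^ 2

/-- Derivative of the side opposite to `i` with respect to the conformal factor at `i + 1`. -/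
def sideDerivNext (C S I : Fin 3 → ℝ) (i : Fin 3) : ℝ :=
  S (i + 1) * (S (i + 1) * C (i + 2) + I i * C (i + 1) * S (i + 2))

/-- Derivative of the side opposite to `i` with respect to the conformal factor at `i + 2`. -/
def sideDerivPrev (C S I : Fin 3 → ℝ) (i : Fin 3) : ℝ :=
  S (i + 2) * (S (i + 2) * C (i + 1) + I i * C (i + 2) * S (i + 1))

/-- Derivative of the angle at `i + 1` with respect to the conformal factor at `i + 2`, up to a
positive factor. -/
def mixedNum (C S I : Fin 3 → ℝ) (i : Fin 3) : ℝ :=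
  S (i + 1) * S (i + 2) *
    (C i * S (i + 1) * S (i + 2) * (1 - I i ^ 2)
      + C (i + 1) * S (i + 2) * S i * (I (i + 2) + I i * I (i + 1))
      + C (i + 2) * S (i + 1) * S i * (I (i + 1) + I i * I (i + 2)))

/-- The variation of a side length multiplied by the `sinh` of that side (by the length itself when
`ε = 0`), which keeps it polynomial. -/
def sideVar (C S I w : Fin 3 → ℝ) (i : Fin 3) : ℝ :=
  w (i + 1) * sideDerivNext C S I i + w (i + 2) * sideDerivPrev C S I i

/-- The derivative of the angle at `i` in the direction `w`, times `√areaSq`. -/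
noncomputable def angleVar (ε : ℝ) (C S I w : Fin 3 → ℝ) (i : Fin 3) : ℝ :=
  sideVar C S I w i
    - cosNum ε C S I (i + 2) / sinhSqSide ε C S I (i + 1) * sideVar C S I w (i + 1)
    - cosNum ε C S I (i + 1) / sinhSqSide ε C S I (i + 2) * sideVar C S I w (i + 2)

/-! ### Trigonometric identities -/

section Identities

theorem add_one_one (i : Fin 3) : i + 1 + 1 = i + 2 := by fin_cases i <;> rfl
theorem add_one_two (i : Fin 3) : i + 1 + 2 = i := by fin_cases i <;> rfl
theorem add_two_one (i : Fin 3) : i + 2 + 1 = i := by fin_cases i <;> rfl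
theorem add_two_two (i : Fin 3) : i + 2 + 2 = i + 1 := by fin_cases i <;> rfl

variable {ε : ℝ} {C S I : Fin 3 → ℝ}

theorem coshSide_sq (h : ∀ i, C i ^ 2 = 1 + ε * S i ^ 2) (i : Fin 3) :
    coshSide ε C S I i ^ 2 = 1 + ε * sinhSqSide ε C S I i := by
  have h1 := h (i + 1)
  have h2 := h (i + 2)
  simp only [coshSide, sinhSqSide]
  grind

/-- For `ε = 0` this is the projection formula `c = b cos A + a cos B`, multiplied by `c`. -/
theorem cosNum_add_next (h : ∀ i, C i ^ 2 = 1 + ε * S i ^ 2) (i : Fin 3) :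
    cosNum ε C S I i + cosNum ε C S I (i + 1) * coshSide ε C S I (i + 2)
      = coshSide ε C S I i * sinhSqSide ε C S I (i + 2) := by
  have h0 := h i
  have h1 := h (i + 1)
  have h2 := h (i + 2)
  simp only [coshSide, sinhSqSide, cosNum, add_one_one, add_one_two, add_two_one, add_two_two]
  generalize C i = C0 at *; generalize C (i + 1) = C1 at *; generalize C (i + 2) = C2 at *
  generalize S i = S0 at *; generalize S (i + 1) = S1 at *; generalize S (i + 2) = S2 at *
  grind

theorem cosNum_add_prev (h : ∀ i, C i ^ 2 = 1 + ε * S i ^ 2) (i : Fin 3) :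
    cosNum ε C S I i + cosNum ε C S I (i + 2) * coshSide ε C S I (i + 1)
      = coshSide ε C S I i * sinhSqSide ε C S I (i + 1) := by
  have h0 := h i
  have h1 := h (i + 1)
  have h2 := h (i + 2)
  simp only [coshSide, sinhSqSide, cosNum, add_one_one, add_one_two, add_two_one, add_two_two]
  generalize C i = C0 at *; generalize C (i + 1) = C1 at *; generalize C (i + 2) = C2 at *
  generalize S i = S0 at *; generalize S (i + 1) = S1 at *; generalize S (i + 2) = S2 at *
  grind

/-- The law of sines, squared and cleared of denominators. -/
theorem areaSq_next (h : ∀ i, C i ^ 2 = 1 + ε * S i ^ 2) (i : Fin 3) :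
    sinhSqSide ε C S I (i + 1) * sinhSqSide ε C S I (i + 2) - cosNum ε C S I i ^ 2
      = sinhSqSide ε C S I (i + 2) * sinhSqSide ε C S I i - cosNum ε C S I (i + 1) ^ 2 := by
  have h0 := h i
  have h1 := h (i + 1)
  have h2 := h (i + 2)
  simp only [sinhSqSide, cosNum, add_one_one, add_one_two, add_two_one, add_two_two]
  generalize C i = C0 at *; generalize C (i + 1) = C1 at *; generalize C (i + 2) = C2 at *
  generalize S i = S0 at *; generalize S (i + 1) = S1 at *; generalize S (i + 2) = S2 at *
  grind

theorem areaSq_eq (h : ∀ i, C i ^ 2 = 1 + ε * S i ^ 2) (i : Fin 3) :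
    sinhSqSide ε C S I (i + 1) * sinhSqSide ε C S I (i + 2) - cosNum ε C S I i ^ 2
      = areaSq ε C S I := by
  have h0 := areaSq_next (I := I) h 0
  have h1 := areaSq_next (I := I) h 1
  fin_cases i
  · rfl
  · exact h0.symm
  · exact h1.symm.trans h0.symm

/-- The dual law of cosines `cos A + cos B cos C = cosh a sin B sin C`. -/
theorem cosNum_mul_sinhSqSide (h : ∀ i, C i ^ 2 = 1 + ε * S i ^ 2) (i : Fin 3) :
    cosNum ε C S I i * sinhSqSide ε C S I i + cosNum ε C S I (i + 1) * cosNum ε C S I (i + 2)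
      = coshSide ε C S I i * areaSq ε C S I := by
  rw [← areaSq_eq h i]
  have h0 := h i
  have h1 := h (i + 1)
  have h2 := h (i + 2)
  simp only [coshSide, sinhSqSide, cosNum, add_one_one, add_one_two, add_two_one, add_two_two]
  generalize C i = C0 at *; generalize C (i + 1) = C1 at *; generalize C (i + 2) = C2 at *
  generalize S i = S0 at *; generalize S (i + 1) = S1 at *; generalize S (i + 2) = S2 at *
  grind

/-- For `ε = 0` the law of cosines; for `ε = 1` the Gram determinant of the `cosh` of the sides. -/
theorem mul_areaSq (h : ∀ i, C i ^ 2 = 1 + ε * S i ^ 2) (i : Fin 3) :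
    ε * areaSq ε C S I = sinhSqSide ε C S I i + 2 * cosNum ε C S I i * coshSide ε C S I i
      - sinhSqSide ε C S I (i + 1) - sinhSqSide ε C S I (i + 2) := by
  rw [← areaSq_eq h i]
  have h0 := h i
  have h1 := h (i + 1)
  have h2 := h (i + 2)
  simp only [coshSide, sinhSqSide, cosNum, add_one_one, add_one_two, add_two_one, add_two_two]
  generalize C i = C0 at *; generalize C (i + 1) = C1 at *; generalize C (i + 2) = C2 at *
  generalize S i = S0 at *; generalize S (i + 1) = S1 at *; generalize S (i + 2) = S2 at *
  grind

theorem mixedNum_eq_next (h : ∀ i, C i ^ 2 = 1 + ε * S i ^ 2) (i : Fin 3) :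
    sideDerivNext C S I (i + 1) * sinhSqSide ε C S I i
      - sideDerivPrev C S I i * cosNum ε C S I (i + 2) = mixedNum C S I i := by
  have h0 := h i
  have h1 := h (i + 1)
  have h2 := h (i + 2)
  simp only [sideDerivNext, sideDerivPrev, mixedNum, sinhSqSide, cosNum, add_one_one, add_one_two,
    add_two_one, add_two_two]
  generalize C i = C0 at *; generalize C (i + 1) = C1 at *; generalize C (i + 2) = C2 at *
  generalize S i = S0 at *; generalize S (i + 1) = S1 at *; generalize S (i + 2) = S2 at *
  grind

/-- Together with `mixedNum_eq_next` this is the symmetry of the Jacobian of the angles, so that the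
angles form a gradient. -/
theorem mixedNum_eq_prev (h : ∀ i, C i ^ 2 = 1 + ε * S i ^ 2) (i : Fin 3) :
    sideDerivPrev C S I (i + 2) * sinhSqSide ε C S I i
      - sideDerivNext C S I i * cosNum ε C S I (i + 1) = mixedNum C S I i := by
  have h0 := h i
  have h1 := h (i + 1)
  have h2 := h (i + 2)
  simp only [sideDerivNext, sideDerivPrev, mixedNum, sinhSqSide, cosNum, add_one_one, add_one_two,
    add_two_one, add_two_two]
  generalize C i = C0 at *; generalize C (i + 1) = C1 at *; generalize C (i + 2) = C2 at *
  generalize S i = S0 at *; generalize S (i + 1) = S1 at *; generalize S (i + 2) = S2 at *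
  grind

end Identities

end InversiveTriangle

namespace InversiveTriangle

/-! ### Signs of the side and angle derivatives -/

section Positivity

variable {ε : ℝ} {C S I : Fin 3 → ℝ}

/-- No triangle inequality enters, so the extended angles stay continuous across degenerate
triangles. -/
theorem sinhSqSide_pos (hε : 0 ≤ ε) (hC : ∀ i, 0 < C i) (hS : ∀ i, 0 < S i) (hI : ∀ i, 0 ≤ I i)
    (i : Fin 3) : 0 < sinhSqSide ε C S I i := by
  have := hC (i + 1); have := hC (i + 2); have := hS (i + 1); have := hS (i + 2); have := hI i
  unfold sinhSqSide
  positivity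

theorem coshSide_pos (hε : 0 ≤ ε) (hC : ∀ i, 0 < C i) (hS : ∀ i, 0 < S i) (hI : ∀ i, 0 ≤ I i)
    (i : Fin 3) : 0 < coshSide ε C S I i := by
  have := hC (i + 1); have := hC (i + 2); have := hS (i + 1); have := hS (i + 2); have := hI i
  unfold coshSide
  positivity

theorem sideDerivNext_pos (hC : ∀ i, 0 < C i) (hS : ∀ i, 0 < S i) (hI : ∀ i, 0 ≤ I i)
    (i : Fin 3) : 0 < sideDerivNext C S I i := by
  have := hC (i + 1); have := hC (i + 2); have := hS (i + 1); have := hS (i + 2); have := hI i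
  unfold sideDerivNext
  positivity

theorem sideDerivPrev_pos (hC : ∀ i, 0 < C i) (hS : ∀ i, 0 < S i) (hI : ∀ i, 0 ≤ I i)
    (i : Fin 3) : 0 < sideDerivPrev C S I i := by
  have := hC (i + 1); have := hC (i + 2); have := hS (i + 1); have := hS (i + 2); have := hI i
  unfold sideDerivPrev
  positivity

/-- If both were nonpositive, then `α ^ 2 ≥ 1` and `β ^ 2 ≥ 1`, while multiplying the two
inequalities gives `α ^ 2 + β ^ 2 + γ ^ 2 + 2 * α * β * γ ≤ 1`. -/
theorem not_both_nonpos {x y a b α β γ : ℝ} {u v w : ℝ} (hu : 0 < u) (hv : 0 < v) (hw : 0 < w)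
    (hα : 0 ≤ α) (hβ : 0 ≤ β) (hγ : 0 ≤ γ) (hx : x = u * (1 - α ^ 2) + v * (γ + α * β) + w * a)
    (hy : y = v * (1 - β ^ 2) + u * (γ + α * β) + w * b) (ha : 0 ≤ a) (hb : 0 ≤ b)
    (hx0 : x ≤ 0) (hy0 : y ≤ 0) : False := by
  have h1 : v * (γ + α * β) ≤ u * (α ^ 2 - 1) := by nlinarith [mul_nonneg hw.le ha]
  have h2 : u * (γ + α * β) ≤ v * (β ^ 2 - 1) := by nlinarith [mul_nonneg hw.le hb]
  have hαβ : 0 ≤ α * β := mul_nonneg hα hβ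
  have h3 : (v * (γ + α * β)) * (u * (γ + α * β)) ≤ (u * (α ^ 2 - 1)) * (v * (β ^ 2 - 1)) :=
    mul_le_mul h1 h2 (by positivity) (le_trans (by positivity) h1)
  have h4 : (γ + α * β) ^ 2 ≤ (α ^ 2 - 1) * (β ^ 2 - 1) := by
    refine le_of_mul_le_mul_left ?_ (mul_pos hu hv)
    nlinarith
  have h5 : 0 ≤ α ^ 2 - 1 := by
    by_contra hneg
    nlinarith [mul_nonneg hv.le (add_nonneg hγ hαβ)]
  nlinarith [sq_nonneg β, mul_nonneg hγ hαβ, sq_nonneg γ]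

/-- At most one of the mixed derivatives of the angles is nonpositive. -/
theorem mixedNum_pos_or (hC : ∀ i, 0 < C i) (hS : ∀ i, 0 < S i) (hI : ∀ i, 0 ≤ I i) (i : Fin 3) :
    0 < mixedNum C S I (i + 1) ∨ 0 < mixedNum C S I (i + 2) := by
  by_contra! hcon
  obtain ⟨h1, h2⟩ := hcon
  have c0 := hC i; have c1 := hC (i + 1); have c2 := hC (i + 2)
  have s0 := hS i; have s1 := hS (i + 1); have s2 := hS (i + 2)
  have i0 := hI i; have i1 := hI (i + 1); have i2 := hI (i + 2)
  simp only [mixedNum, add_one_one, add_one_two, add_two_one, add_two_two] at h1 h2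
  have h1' := nonpos_of_mul_nonpos_right h1 (by positivity)
  have h2' := nonpos_of_mul_nonpos_right h2 (by positivity)
  exact not_both_nonpos (u := C (i + 1) * S (i + 2) * S i * S (i + 2))
    (v := C (i + 2) * S (i + 1) * S i * S (i + 2)) (w := C i * S (i + 2) * S (i + 1) * S (i + 2))
    (by positivity) (by positivity) (by positivity) i1 i2 i0
    (x := (C (i + 1) * S (i + 2) * S i * (1 - I (i + 1) ^ 2)
      + C (i + 2) * S i * S (i + 1) * (I i + I (i + 1) * I (i + 2))
      + C i * S (i + 2) * S (i + 1) * (I (i + 2) + I (i + 1) * I i)) * S (i + 2))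
    (y := (C (i + 2) * S i * S (i + 1) * (1 - I (i + 2) ^ 2)
      + C i * S (i + 1) * S (i + 2) * (I (i + 1) + I (i + 2) * I i)
      + C (i + 1) * S i * S (i + 2) * (I i + I (i + 2) * I (i + 1))) * S (i + 2))
    (a := I (i + 2) + I (i + 1) * I i) (b := I (i + 1) + I (i + 2) * I i)
    (by ring) (by ring) (by positivity) (by positivity)
    (mul_nonpos_of_nonpos_of_nonneg h1' s2.le) (mul_nonpos_of_nonpos_of_nonneg h2' s2.le)

theorem exists_mixedNum_pos (hC : ∀ i, 0 < C i) (hS : ∀ i, 0 < S i) (hI : ∀ i, 0 ≤ I i) :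
    ∃ i, 0 < mixedNum C S I (i + 1) ∧ 0 < mixedNum C S I (i + 2) := by
  have h0 := mixedNum_pos_or hC hS hI 0
  have h1 := mixedNum_pos_or hC hS hI 1
  have h2 := mixedNum_pos_or hC hS hI 2
  by_contra! hcon
  have k0 := hcon 0
  have k1 := hcon 1
  have k2 := hcon 2
  simp only [Fin.isValue, Fin.reduceAdd, zero_add] at *
  grind

/-- The numerator of a principal `2 × 2` minor of the Jacobian of the angles. -/
theorem minorNum_pos (hε : 0 ≤ ε) (h : ∀ i, C i ^ 2 = 1 + ε * S i ^ 2) (hC : ∀ i, 0 < C i)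
    (hS : ∀ i, 0 < S i) (hI : ∀ i, 0 ≤ I i) (i : Fin 3) (hN : 0 < mixedNum C S I (i + 2)) :
    0 < sinhSqSide ε C S I (i + 1) * coshSide ε C S I i
          * sideDerivNext C S I i * sideDerivNext C S I (i + 2)
        + sinhSqSide ε C S I i * coshSide ε C S I (i + 1)
          * sideDerivPrev C S I (i + 1) * sideDerivPrev C S I (i + 2)
        - sinhSqSide ε C S I (i + 2) * sideDerivNext C S I i * sideDerivPrev C S I (i + 1) := by
  have p1 := coshSide_pos hε hC hS hI i
  have p2 := coshSide_pos hε hC hS hI (i + 1)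
  have h0 := h i; have h1 := h (i + 1); have h2 := h (i + 2)
  have c0 := hC i; have c1 := hC (i + 1); have c2 := hC (i + 2)
  have s0 := hS i; have s1 := hS (i + 1); have s2 := hS (i + 2)
  have i0 := hI i; have i1 := hI (i + 1); have i2 := hI (i + 2)
  -- After multiplication by `C (i + 2)`, this identity splits the only negative term of the goal
  -- between the two positive ones, leaving the factors of `q0` and `q1` and a multiple of
  -- `mixedNum`.
  have key : C (i + 2) * sinhSqSide ε C S I (i + 2)
      + ε * mixedNum C S I (i + 2) =
      sideDerivNext C S I (i + 2) * coshSide ε C S I i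
      + sideDerivPrev C S I (i + 2) * coshSide ε C S I (i + 1) := by
    simp only [sideDerivNext, sideDerivPrev, mixedNum, sinhSqSide, coshSide, add_one_one,
      add_one_two, add_two_one, add_two_two]
    linear_combination (-C (i + 2)) * (S i ^ 2 * h1 + S (i + 1) ^ 2 * h0)
  have q0 : 0 < C (i + 2) * sinhSqSide ε C S I i - sideDerivNext C S I i := by
    have : C (i + 2) * sinhSqSide ε C S I i - sideDerivNext C S I i
        = C (i + 2) * S (i + 2) ^ 2 * (1 + ε * (1 + I i ^ 2) * S (i + 1) ^ 2)
          + I i * C (i + 1) * S (i + 1) * S (i + 2) * (1 + 2 * ε * S (i + 2) ^ 2) := by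
      simp only [sinhSqSide, sideDerivNext]
      linear_combination (2 * I i * C (i + 1) * S (i + 1) * S (i + 2)) * h2
    rw [this]
    positivity
  have q1 : 0 < C (i + 2) * sinhSqSide ε C S I (i + 1) - sideDerivPrev C S I (i + 1) := by
    have : C (i + 2) * sinhSqSide ε C S I (i + 1) - sideDerivPrev C S I (i + 1)
        = C (i + 2) * S (i + 2) ^ 2 * (1 + ε * (1 + I (i + 1) ^ 2) * S i ^ 2)
          + I (i + 1) * C i * S i * S (i + 2) * (1 + 2 * ε * S (i + 2) ^ 2) := by
      simp only [sinhSqSide, sideDerivPrev, add_one_one, add_one_two]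
      linear_combination (2 * I (i + 1) * C i * S i * S (i + 2)) * h2
    rw [this]
    positivity
  have d1 := sideDerivNext_pos hC hS hI i
  have d2 := sideDerivPrev_pos hC hS hI (i + 1)
  have d3 := sideDerivNext_pos hC hS hI (i + 2)
  have d4 := sideDerivPrev_pos hC hS hI (i + 2)
  generalize sideDerivNext C S I i = a at *
  generalize sideDerivPrev C S I (i + 1) = b at *
  generalize sideDerivNext C S I (i + 2) = f at *
  generalize sideDerivPrev C S I (i + 2) = k at *
  generalize mixedNum C S I (i + 2) = n at *
  generalize coshSide ε C S I i = x at *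
  generalize coshSide ε C S I (i + 1) = y at *
  generalize sinhSqSide ε C S I i = q at *
  generalize sinhSqSide ε C S I (i + 1) = q' at *
  generalize sinhSqSide ε C S I (i + 2) = q'' at *
  refine pos_of_mul_pos_right (a := C (i + 2)) ?_ c2.le
  have e : C (i + 2) * (q' * x * a * f + q * y * b * k - q'' * a * b)
      = a * b * (ε * n) + (x * a * f * (C (i + 2) * q' - b)
        + y * b * k * (C (i + 2) * q - a)) := by
    linear_combination (-a * b) * key
  rw [e]
  positivity

end Positivity

end InversiveTriangle

/-! ### Definiteness of the Hessian of one triangle -/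

namespace InversiveTriangle

/-- Sylvester's criterion: squares are completed twice, with the leading minors multiplied in to
avoid division. -/
theorem quadraticForm_nonneg {A B D u v z w₀ w₁ w₂ : ℝ} (hA : 0 < A) (hM : 0 < A * B - u ^ 2)
    (hdet : 0 ≤ A * B * D + 2 * u * v * z - A * z ^ 2 - B * v ^ 2 - D * u ^ 2) :
    0 ≤ A * w₀ ^ 2 + B * w₁ ^ 2 + D * w₂ ^ 2 + 2 * u * w₀ * w₁ + 2 * v * w₀ * w₂
      + 2 * z * w₁ * w₂ := by
  refine nonneg_of_mul_nonneg_right (a := A * (A * B - u ^ 2)) ?_ (mul_pos hA hM)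
  have e : A * (A * B - u ^ 2) * (A * w₀ ^ 2 + B * w₁ ^ 2 + D * w₂ ^ 2 + 2 * u * w₀ * w₁
      + 2 * v * w₀ * w₂ + 2 * z * w₁ * w₂)
      = (A * B - u ^ 2) * (A * w₀ + u * w₁ + v * w₂) ^ 2
        + ((A * B - u ^ 2) * w₁ + (A * z - u * v) * w₂) ^ 2
        + A * (A * B * D + 2 * u * v * z - A * z ^ 2 - B * v ^ 2 - D * u ^ 2) * w₂ ^ 2 := by
    ring
  rw [e]
  positivity

/-- The alternative `w₂ = 0` serves the Euclidean case, where the determinant vanishes and constants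
are subtracted first. -/
theorem eq_zero_of_quadraticForm_eq_zero {A B D u v z w₀ w₁ w₂ : ℝ} (hA : 0 < A)
    (hM : 0 < A * B - u ^ 2)
    (hdet : 0 ≤ A * B * D + 2 * u * v * z - A * z ^ 2 - B * v ^ 2 - D * u ^ 2)
    (h0 : 0 < A * B * D + 2 * u * v * z - A * z ^ 2 - B * v ^ 2 - D * u ^ 2 ∨ w₂ = 0)
    (h : A * w₀ ^ 2 + B * w₁ ^ 2 + D * w₂ ^ 2 + 2 * u * w₀ * w₁ + 2 * v * w₀ * w₂
      + 2 * z * w₁ * w₂ = 0) : w₀ = 0 ∧ w₁ = 0 ∧ w₂ = 0 := by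
  have e : A * (A * B - u ^ 2) * (A * w₀ ^ 2 + B * w₁ ^ 2 + D * w₂ ^ 2 + 2 * u * w₀ * w₁
      + 2 * v * w₀ * w₂ + 2 * z * w₁ * w₂)
      = (A * B - u ^ 2) * (A * w₀ + u * w₁ + v * w₂) ^ 2
        + ((A * B - u ^ 2) * w₁ + (A * z - u * v) * w₂) ^ 2
        + A * (A * B * D + 2 * u * v * z - A * z ^ 2 - B * v ^ 2 - D * u ^ 2) * w₂ ^ 2 := by
    ring
  rw [h, mul_zero] at e
  have t1 : 0 ≤ (A * B - u ^ 2) * (A * w₀ + u * w₁ + v * w₂) ^ 2 := by positivity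
  have t2 : 0 ≤ ((A * B - u ^ 2) * w₁ + (A * z - u * v) * w₂) ^ 2 := by positivity
  have t3 : 0 ≤ A * (A * B * D + 2 * u * v * z - A * z ^ 2 - B * v ^ 2 - D * u ^ 2) * w₂ ^ 2 := by
    positivity
  have z2 : w₂ = 0 := by
    rcases h0 with h0 | h0
    · have : A * (A * B * D + 2 * u * v * z - A * z ^ 2 - B * v ^ 2 - D * u ^ 2) * w₂ ^ 2 = 0 := by
        linarith
      have hpos := mul_pos hA h0
      simpa [hpos.ne'] using this
    · exact h0
  have z1 : w₁ = 0 := by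
    have : ((A * B - u ^ 2) * w₁ + (A * z - u * v) * w₂) ^ 2 = 0 := by linarith
    rw [z2] at this
    simpa [hM.ne'] using this
  have z0 : w₀ = 0 := by
    have : (A * B - u ^ 2) * (A * w₀ + u * w₁ + v * w₂) ^ 2 = 0 := by linarith
    rw [z2, z1] at this
    simpa [hM.ne', hA.ne'] using this
  exact ⟨z0, z1, z2⟩

section Scalars

variable {ε Δ p01 p02 p10 p12 p20 p21 g0 g1 g2 q0 q1 q2 c0 c1 c2 n0 n1 n2 : ℝ}

/-- In this section `pij` is the derivative of side `i` by factor `j`, and `g`, `q`, `c`, `n` stand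
for `cosNum`, `sinhSqSide`, `coshSide`, `mixedNum`. Two positive mixed derivatives thus force a
positive diagonal entry; when all `c` are `1`, rows sum to zero, which is scale invariance. -/
theorem diag_eq (hq1 : q1 ≠ 0) (hq2 : q2 ≠ 0)
    (hn1 : p20 * q1 - p10 * g0 = n1) (hn2 : p10 * q2 - p20 * g0 = n2)
    (ha1 : g2 + g0 * c1 = c2 * q1) (ha2 : g1 + g0 * c2 = c1 * q2) :
    p10 * g2 / q1 + p20 * g1 / q2 = n1 / q1 * c1 + n2 / q2 * c2 := by
  subst hn1 hn2
  have e2 : g2 = c2 * q1 - g0 * c1 := by linarith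
  have e1 : g1 = c1 * q2 - g0 * c2 := by linarith
  subst e1 e2
  field_simp
  ring

theorem minor_eq (hq0 : q0 ≠ 0) (hq1 : q1 ≠ 0) (hq2 : q2 ≠ 0)
    (hn2 : p10 * q2 - p20 * g0 = n2) (hn2' : p01 * q2 - p21 * g1 = n2)
    (har : q0 * q1 - g2 ^ 2 = Δ)
    (h0 : g0 * q0 + g1 * g2 = c0 * Δ) (h1 : g1 * q1 + g2 * g0 = c1 * Δ) :
    (p10 * g2 / q1 + p20 * g1 / q2) * (p01 * g2 / q0 + p21 * g0 / q2) - (-(n2 / q2)) ^ 2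
      = Δ / (q0 * q1 * q2) * (q1 * c0 * p01 * p20 + q0 * c1 * p10 * p21 - q2 * p01 * p10) := by
  have e : (-(n2 / q2)) ^ 2 = (p10 * q2 - p20 * g0) * (p01 * q2 - p21 * g1) / q2 ^ 2 := by
    rw [hn2, hn2']; ring
  rw [e]
  field_simp
  linear_combination q2 * ((-p01 * p10 * q2) * har + (q1 * p01 * p20) * h0
    + (q0 * p10 * p21) * h1)

/-- The matrix is, up to normalization, the angle-by-side Jacobian times the side-by-factor
Jacobian. The latter has zero diagonal, whence the two cyclic products; the former contributes `ε *
Δ ^ 2`. -/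
theorem det_eq (hq0 : q0 ≠ 0) (hq1 : q1 ≠ 0) (hq2 : q2 ≠ 0)
    (hn0 : p21 * q0 - p01 * g1 = n0) (hn0' : p12 * q0 - p02 * g2 = n0)
    (hn1 : p02 * q1 - p12 * g2 = n1) (hn1' : p20 * q1 - p10 * g0 = n1)
    (hn2 : p10 * q2 - p20 * g0 = n2) (hn2' : p01 * q2 - p21 * g1 = n2)
    (ha0 : q1 * q2 - g0 ^ 2 = Δ) (ha1 : q2 * q0 - g1 ^ 2 = Δ) (ha2 : q0 * q1 - g2 ^ 2 = Δ)
    (h0 : g0 * q0 + g1 * g2 = c0 * Δ) (hε : ε * Δ = q0 + 2 * g0 * c0 - q1 - q2) :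
    (p10 * g2 / q1 + p20 * g1 / q2) * (p01 * g2 / q0 + p21 * g0 / q2)
        * (p02 * g1 / q0 + p12 * g0 / q1)
      + 2 * (-(n2 / q2)) * (-(n1 / q1)) * (-(n0 / q0))
      - (p10 * g2 / q1 + p20 * g1 / q2) * (-(n0 / q0)) ^ 2
      - (p01 * g2 / q0 + p21 * g0 / q2) * (-(n1 / q1)) ^ 2
      - (p02 * g1 / q0 + p12 * g0 / q1) * (-(n2 / q2)) ^ 2
      = ε * Δ ^ 2 / (q0 * q1 * q2) * (p01 * p12 * p20 + p02 * p21 * p10) := by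
  have key : 2 * g0 * g1 * g2 + q0 * g0 ^ 2 + q1 * g1 ^ 2 + q2 * g2 ^ 2 - q0 * q1 * q2
      = ε * Δ ^ 2 := by
    linear_combination 2 * g0 * h0 - Δ * hε + q0 * ha0 - q1 * ha1 - q2 * ha2
  have e0 : (n0 / q0) ^ 2 = (p21 * q0 - p01 * g1) * (p12 * q0 - p02 * g2) / q0 ^ 2 := by
    rw [hn0, hn0']; ring
  have e1 : (n1 / q1) ^ 2 = (p02 * q1 - p12 * g2) * (p20 * q1 - p10 * g0) / q1 ^ 2 := by
    rw [hn1, hn1']; ring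
  have e2 : (n2 / q2) ^ 2 = (p10 * q2 - p20 * g0) * (p01 * q2 - p21 * g1) / q2 ^ 2 := by
    rw [hn2, hn2']; ring
  -- Each of the two copies of the product uses one of the two expressions of the mixed derivatives,
  -- matching the two cyclic terms of the determinant.
  have e3 : 2 * (-(n2 / q2)) * (-(n1 / q1)) * (-(n0 / q0))
      = -((p10 * q2 - p20 * g0) * (p02 * q1 - p12 * g2) * (p21 * q0 - p01 * g1)
        + (p01 * q2 - p21 * g1) * (p20 * q1 - p10 * g0) * (p12 * q0 - p02 * g2))
          / (q0 * q1 * q2) := by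
    rw [hn0, hn0', hn1, hn1', hn2, hn2']; ring
  rw [e3, neg_sq, neg_sq, neg_sq, e0, e1, e2, ← key]
  field_simp
  ring

end Scalars

section Form

variable {ε : ℝ} {C S I w : Fin 3 → ℝ}

/-- Minus the second derivative, in the direction `w`, of the energy of the triangle, times
`√areaSq`. -/
noncomputable def form (ε : ℝ) (C S I w : Fin 3 → ℝ) : ℝ := -∑ i, w i * angleVar ε C S I w i

theorem form_eq (hε : 0 ≤ ε) (h : ∀ i, C i ^ 2 = 1 + ε * S i ^ 2) (hC : ∀ i, 0 < C i)
    (hS : ∀ i, 0 < S i) (hI : ∀ i, 0 ≤ I i) (hΔ : 0 < areaSq ε C S I) :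
    ∃ (i : Fin 3) (A B D u v z : ℝ), 0 < A ∧ 0 < A * B - u ^ 2 ∧
      0 ≤ A * B * D + 2 * u * v * z - A * z ^ 2 - B * v ^ 2 - D * u ^ 2 ∧
      (0 < ε → 0 < A * B * D + 2 * u * v * z - A * z ^ 2 - B * v ^ 2 - D * u ^ 2) ∧
      ((∀ i, coshSide ε C S I i = 1) → A + u + v = 0 ∧ B + u + z = 0 ∧ D + v + z = 0) ∧
      form ε C S I w = A * w i ^ 2 + B * w (i + 1) ^ 2 + D * w (i + 2) ^ 2
        + 2 * u * w i * w (i + 1) + 2 * v * w i * w (i + 2) + 2 * z * w (i + 1) * w (i + 2) := by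
  -- The corner is chosen so that its first diagonal entry and first `2 × 2` minor are visibly
  -- positive.
  obtain ⟨i, hN1, hN2⟩ := exists_mixedNum_pos hC hS hI
  have hsum : form ε C S I w = -(w i * angleVar ε C S I w i
      + w (i + 1) * angleVar ε C S I w (i + 1) + w (i + 2) * angleVar ε C S I w (i + 2)) := by
    rw [form, Fin.sum_univ_three]
    fin_cases i <;> simp only [Fin.isValue, Fin.reduceFinMk, Fin.zero_eta, Fin.mk_one,
      Fin.reduceAdd, zero_add] <;> ring
  have hE := minorNum_pos hε h hC hS hI i hN2
  have q0 := sinhSqSide_pos hε hC hS hI i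
  have q1 := sinhSqSide_pos hε hC hS hI (i + 1)
  have q2 := sinhSqSide_pos hε hC hS hI (i + 2)
  have c1 := coshSide_pos hε hC hS hI (i + 1)
  have c2 := coshSide_pos hε hC hS hI (i + 2)
  have p01 := sideDerivNext_pos hC hS hI i
  have p12 := sideDerivNext_pos hC hS hI (i + 1)
  have p20 := sideDerivNext_pos hC hS hI (i + 2)
  have p02 := sideDerivPrev_pos hC hS hI i
  have p10 := sideDerivPrev_pos hC hS hI (i + 1)
  have p21 := sideDerivPrev_pos hC hS hI (i + 2)
  have n0 := mixedNum_eq_next (I := I) h i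
  have n1 := mixedNum_eq_next (I := I) h (i + 1)
  have n2 := mixedNum_eq_next (I := I) h (i + 2)
  have n0' := mixedNum_eq_prev (I := I) h i
  have n1' := mixedNum_eq_prev (I := I) h (i + 1)
  have n2' := mixedNum_eq_prev (I := I) h (i + 2)
  have a0 := areaSq_eq (I := I) h i
  have a1 := areaSq_eq (I := I) h (i + 1)
  have a2 := areaSq_eq (I := I) h (i + 2)
  have m0 := cosNum_mul_sinhSqSide (I := I) h i
  have m1 := cosNum_mul_sinhSqSide (I := I) h (i + 1)
  have hεΔ := mul_areaSq (I := I) h i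
  have s0 := cosNum_add_next (I := I) h i
  have s1 := cosNum_add_next (I := I) h (i + 1)
  have s2 := cosNum_add_next (I := I) h (i + 2)
  have t0 := cosNum_add_prev (I := I) h i
  have t1 := cosNum_add_prev (I := I) h (i + 1)
  have t2 := cosNum_add_prev (I := I) h (i + 2)
  simp only [angleVar, sideVar, add_one_one, add_one_two, add_two_one, add_two_two] at *
  have d0 := diag_eq q1.ne' q2.ne' n1 n2' s2 t1
  have d1 := diag_eq q2.ne' q0.ne' n2 n0' s0 t2
  have d2 := diag_eq q0.ne' q1.ne' n0 n1' s1 t0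
  have hm := minor_eq q0.ne' q1.ne' q2.ne' n2' n2 a2 m0 m1
  have hd := det_eq q0.ne' q1.ne' q2.ne' n0' n0 n1' n1 n2' n2 a0 a1 a2 m0 hεΔ
  -- The matrix entries are read off by unification with `hm` and `hd`.
  refine ⟨i, _, _, _, _, _, _, ?_, lt_of_lt_of_eq ?_ hm.symm,
    le_of_le_of_eq ?_ hd.symm, fun hε' => lt_of_lt_of_eq ?_ hd.symm, fun hc => ?_, ?_⟩
  · rw [d0]; positivity
  · exact mul_pos (by positivity) (by linarith)
  · positivity
  · positivity
  · simp only [hc, mul_one] at d0 d1 d2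
    exact ⟨by linarith, by linarith, by linarith⟩
  · rw [hsum]
    have e0 : mixedNum C S I i / sinhSqSide ε C S I i = sideDerivNext C S I (i + 1)
        - sideDerivPrev C S I i * cosNum ε C S I (i + 2) / sinhSqSide ε C S I i := by
      rw [← n0]; field_simp
    have e1 : mixedNum C S I (i + 1) / sinhSqSide ε C S I (i + 1) = sideDerivNext C S I (i + 2)
        - sideDerivPrev C S I (i + 1) * cosNum ε C S I i / sinhSqSide ε C S I (i + 1) := by
      rw [← n1]; field_simp
    have e2 : mixedNum C S I (i + 2) / sinhSqSide ε C S I (i + 2) = sideDerivNext C S I i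
        - sideDerivPrev C S I (i + 2) * cosNum ε C S I (i + 1) / sinhSqSide ε C S I (i + 2) := by
      rw [← n2]; field_simp
    have e0' : mixedNum C S I i / sinhSqSide ε C S I i = sideDerivPrev C S I (i + 2)
        - sideDerivNext C S I i * cosNum ε C S I (i + 1) / sinhSqSide ε C S I i := by
      rw [← n0']; field_simp
    have e1' : mixedNum C S I (i + 1) / sinhSqSide ε C S I (i + 1) = sideDerivPrev C S I i
        - sideDerivNext C S I (i + 1) * cosNum ε C S I (i + 2) / sinhSqSide ε C S I (i + 1) := by
      rw [← n1']; field_simp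
    have e2' : mixedNum C S I (i + 2) / sinhSqSide ε C S I (i + 2) = sideDerivPrev C S I (i + 1)
        - sideDerivNext C S I (i + 2) * cosNum ε C S I i / sinhSqSide ε C S I (i + 2) := by
      rw [← n2']; field_simp
    linear_combination (w (i + 1) * w (i + 2)) * (e0 + e0') + (w i * w (i + 2)) * (e1 + e1')
      + (w i * w (i + 1)) * (e2 + e2')

theorem form_nonneg (hε : 0 ≤ ε) (h : ∀ i, C i ^ 2 = 1 + ε * S i ^ 2) (hC : ∀ i, 0 < C i)
    (hS : ∀ i, 0 < S i) (hI : ∀ i, 0 ≤ I i) (hΔ : 0 < areaSq ε C S I) :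
    0 ≤ form ε C S I w := by
  obtain ⟨i, A, B, D, u, v, z, hA, hM, hd, -, -, e⟩ := form_eq (w := w) hε h hC hS hI hΔ
  rw [e]
  exact quadraticForm_nonneg hA hM hd

theorem eq_zero_of_form_eq_zero (hε : 0 < ε) (h : ∀ i, C i ^ 2 = 1 + ε * S i ^ 2)
    (hC : ∀ i, 0 < C i) (hS : ∀ i, 0 < S i) (hI : ∀ i, 0 ≤ I i) (hΔ : 0 < areaSq ε C S I)
    (hw : form ε C S I w = 0) (j : Fin 3) : w j = 0 := by
  obtain ⟨i, A, B, D, u, v, z, hA, hM, hd, hd', -, e⟩ := form_eq (w := w) hε.le h hC hS hI hΔ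
  obtain ⟨h0, h1, h2⟩ := eq_zero_of_quadraticForm_eq_zero hA hM hd (.inl (hd' hε)) (e ▸ hw)
  fin_cases i <;> fin_cases j <;> assumption

theorem eq_of_form_eq_zero (h : ∀ i, C i = 1) (hS : ∀ i, 0 < S i) (hI : ∀ i, 0 ≤ I i)
    (hΔ : 0 < areaSq 0 C S I) (hw : form 0 C S I w = 0) (j k : Fin 3) : w j = w k := by
  obtain ⟨i, A, B, D, u, v, z, hA, hM, hd, -, hc, e⟩ := form_eq (w := w) le_rfl
    (by simp [h]) (by simp [h]) hS hI hΔ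
  obtain ⟨k0, k1, k2⟩ := hc (by simp [coshSide, h])
  -- Zero row sums make the form invariant under adding a constant, so the last coordinate can be
  -- made `0`.
  have e' : A * (w i - w (i + 2)) ^ 2 + B * (w (i + 1) - w (i + 2)) ^ 2
      + D * (w (i + 2) - w (i + 2)) ^ 2 + 2 * u * (w i - w (i + 2)) * (w (i + 1) - w (i + 2))
      + 2 * v * (w i - w (i + 2)) * (w (i + 2) - w (i + 2))
      + 2 * z * (w (i + 1) - w (i + 2)) * (w (i + 2) - w (i + 2)) = 0 := by
    rw [e] at hw
    linear_combination hw - 2 * w i * w (i + 2) * k0 - 2 * w (i + 1) * w (i + 2) * k1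
      + w (i + 2) ^ 2 * (k0 + k1 - k2)
  obtain ⟨h0, h1, -⟩ := eq_zero_of_quadraticForm_eq_zero hA hM hd (.inr (sub_self _)) e'
  rw [sub_eq_zero] at h0 h1
  fin_cases i <;> fin_cases j <;> fin_cases k <;> simp_all

end Form

end InversiveTriangle

/-! ### Monotonicity of the angles along a line of conformal factors -/

namespace InversiveTriangle

open Set

/-- A continuous function whose derivative is nonpositive wherever the function avoids a given
finite set of values does not increase. -/
theorem le_of_deriv_nonpos_off_finite {G : ℝ → ℝ} {a b : ℝ} (hab : a ≤ b)
    (hG : ContinuousOn G (Icc a b)) {A : Set ℝ} (hA : A.Finite)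
    (hd : ∀ t ∈ Ioo a b, G t ∈ A ∨ ∃ d ≤ 0, HasDerivAt G d t) : G b ≤ G a := by
  by_contra! hlt
  -- A window of values from `y` to `z` between `G a` and `G b` that misses `A`. With `t₂` the first
  -- time `G` reaches `z` and `t₁` the last earlier time at or below `y`, `G` stays inside the
  -- window between them, so it cannot rise there.
  obtain ⟨y, hy, hyA⟩ := ((Ioo_infinite hlt).sdiff hA).nonempty
  obtain ⟨l, u, hyl, hlu⟩ := mem_nhds_iff_exists_Ioo_subset.1
    ((isOpen_Ioo.inter hA.isClosed.isOpen_compl).mem_nhds ⟨hy, hyA⟩)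
  set z := (y + u) / 2 with hz
  have hyu : y < z := by linarith [hyl.2]
  have hzu : z < u := by linarith [hyl.2]
  have hzb : z < G b := (hlu ⟨by linarith [hyl.1], hzu⟩).1.2
  obtain ⟨t₂, ⟨ht₂, hGt₂⟩, hmin⟩ :=
    (isCompact_Icc.of_isClosed_subset (hG.preimage_isClosed_of_isClosed isClosed_Icc isClosed_Ici)
      inter_subset_left : IsCompact (Icc a b ∩ G ⁻¹' Ici z)).exists_isLeast
      ⟨b, right_mem_Icc.2 hab, hzb.le⟩
  have hG₂ : ContinuousOn G (Icc a t₂) := hG.mono (Icc_subset_Icc_right ht₂.2)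
  obtain ⟨t₁, ⟨ht₁, hGt₁⟩, hmax⟩ :=
    (isCompact_Icc.of_isClosed_subset (hG₂.preimage_isClosed_of_isClosed isClosed_Icc isClosed_Iic)
      inter_subset_left : IsCompact (Icc a t₂ ∩ G ⁻¹' Iic y)).exists_isGreatest
      ⟨a, left_mem_Icc.2 ht₂.1, hy.1.le⟩
  have hder : ∀ t ∈ Ioo t₁ t₂, ∃ d ≤ 0, HasDerivAt G d t := by
    intro t ht
    have hta : a ≤ t := ht₁.1.trans ht.1.le
    refine (hd t ⟨ht₁.1.trans_lt ht.1, ht.2.trans_le ht₂.2⟩).resolve_left fun hmem => ?_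
    have h1 : y < G t := by
      by_contra! h
      exact ht.1.not_ge (hmax ⟨⟨hta, ht.2.le⟩, h⟩)
    have h2 : G t < z := by
      by_contra! h
      exact ht.2.not_ge (hmin ⟨⟨hta, ht.2.le.trans ht₂.2⟩, h⟩)
    exact (hlu ⟨by linarith [hyl.1], by linarith⟩).2 hmem
  have hanti : AntitoneOn G (Icc t₁ t₂) := by
    refine antitoneOn_of_deriv_nonpos (convex_Icc _ _) (hG₂.mono (Icc_subset_Icc_left ht₁.1)) ?_ ?_
    · intro t ht
      rw [interior_Icc] at ht
      obtain ⟨d, -, h⟩ := hder t ht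
      exact h.differentiableAt.differentiableWithinAt
    · intro t ht
      rw [interior_Icc] at ht
      obtain ⟨d, hd0, h⟩ := hder t ht
      rwa [h.deriv]
  have := hanti (left_mem_Icc.2 ht₁.2) (right_mem_Icc.2 ht₁.2) ht₁.2
  simp only [mem_preimage, mem_Ici, mem_Iic] at hGt₁ hGt₂
  linarith

/-- The inner angle at the corner `i`, extended by `0` and `π` to degenerate triangles. -/
noncomputable def angle (ε : ℝ) (C S I : Fin 3 → ℝ) (i : Fin 3) : ℝ :=
  Real.arccos (cosNum ε C S I i / √(sinhSqSide ε C S I (i + 1) * sinhSqSide ε C S I (i + 2)))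

section Deriv

variable {ε : ℝ} {C S : ℝ → Fin 3 → ℝ} {I w : Fin 3 → ℝ} {t : ℝ}

/-- The hypotheses on `S` and `C` say that the radii move with `dr = S du`, where the conformal
factors `u` have constant velocity `w`. -/
theorem hasDerivAt_sinhSqSide (h : ∀ i, C t i ^ 2 = 1 + ε * S t i ^ 2)
    (hS : ∀ i, HasDerivAt (fun t => S t i) (C t i * S t i * w i) t)
    (hC : ∀ i, HasDerivAt (fun t => C t i) (ε * S t i ^ 2 * w i) t) (i : Fin 3) :
    HasDerivAt (fun t => sinhSqSide ε (C t) (S t) I i)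
      (2 * coshSide ε (C t) (S t) I i * sideVar (C t) (S t) I w i) t := by
  have h1 := h (i + 1); have h2 := h (i + 2)
  have s1 := hS (i + 1); have s2 := hS (i + 2); have c1 := hC (i + 1); have c2 := hC (i + 2)
  have := (((s1.pow 2).add (s2.pow 2)).add
    ((((c1.const_mul (2 * I i)).mul c2).mul s1).mul s2)).add
    (((s1.pow 2).const_mul (ε * (1 + I i ^ 2))).mul (s2.pow 2))
  refine this.congr_deriv ?_
  simp only [coshSide, sideVar, sideDerivNext, sideDerivPrev, Pi.pow_apply, Pi.mul_apply]
  generalize C t (i + 1) = C1 at *; generalize C t (i + 2) = C2 at *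
  generalize S t (i + 1) = S1 at *; generalize S t (i + 2) = S2 at *
  clear this hS hC h s1 s2 c1 c2
  push_cast
  grind

theorem hasDerivAt_cosNum (h : ∀ i, C t i ^ 2 = 1 + ε * S t i ^ 2)
    (hS : ∀ i, HasDerivAt (fun t => S t i) (C t i * S t i * w i) t)
    (hC : ∀ i, HasDerivAt (fun t => C t i) (ε * S t i ^ 2 * w i) t) (i : Fin 3) :
    HasDerivAt (fun t => cosNum ε (C t) (S t) I i)
      (coshSide ε (C t) (S t) I (i + 1) * sideVar (C t) (S t) I w (i + 2)
        + coshSide ε (C t) (S t) I (i + 2) * sideVar (C t) (S t) I w (i + 1)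
        - sideVar (C t) (S t) I w i) t := by
  have h0 := h i; have h1 := h (i + 1); have h2 := h (i + 2)
  have s0 := hS i; have s1 := hS (i + 1); have s2 := hS (i + 2)
  have c0 := hC i; have c1 := hC (i + 1); have c2 := hC (i + 2)
  have := (((((s0.pow 2).mul c1).mul c2).add
    ((((c0.const_mul (I (i + 2))).mul c2).mul s0).mul s1)).add
    ((((c0.const_mul (I (i + 1))).mul c1).mul s0).mul s2)).add
    (((((s0.pow 2).const_mul (ε * I (i + 1) * I (i + 2))).sub_const (I i)).mul s1).mul s2)
  refine this.congr_deriv ?_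
  simp only [coshSide, sideVar, sideDerivNext, sideDerivPrev, Pi.pow_apply, Pi.mul_apply,
    add_one_one, add_one_two, add_two_one, add_two_two]
  generalize C t i = C0 at *; generalize C t (i + 1) = C1 at *; generalize C t (i + 2) = C2 at *
  generalize S t i = S0 at *; generalize S t (i + 1) = S1 at *; generalize S t (i + 2) = S2 at *
  clear this hS hC h s0 s1 s2 c0 c1 c2
  push_cast
  grind

/-- The chain rule for `arccos`, nonsingular since `areaSq` is positive; the projection formulas
then turn the coefficients of the adjacent sides into cosines of the other two angles. -/
theorem hasDerivAt_angle (hε : 0 ≤ ε) (h : ∀ i, C t i ^ 2 = 1 + ε * S t i ^ 2)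
    (hC0 : ∀ i, 0 < C t i) (hS0 : ∀ i, 0 < S t i) (hI : ∀ i, 0 ≤ I i)
    (hS : ∀ i, HasDerivAt (fun t => S t i) (C t i * S t i * w i) t)
    (hC : ∀ i, HasDerivAt (fun t => C t i) (ε * S t i ^ 2 * w i) t)
    (hΔ : 0 < areaSq ε (C t) (S t) I) (i : Fin 3) :
    HasDerivAt (fun t => angle ε (C t) (S t) I i)
      (angleVar ε (C t) (S t) I w i / √(areaSq ε (C t) (S t) I)) t := by
  have q1 := sinhSqSide_pos hε hC0 hS0 hI (i + 1)
  have q2 := sinhSqSide_pos hε hC0 hS0 hI (i + 2)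
  have dq1 := hasDerivAt_sinhSqSide (I := I) h hS hC (i + 1)
  have dq2 := hasDerivAt_sinhSqSide (I := I) h hS hC (i + 2)
  have dg := hasDerivAt_cosNum (I := I) h hS hC i
  have ha := areaSq_eq (I := I) h i
  have s2 := cosNum_add_next (I := I) h (i + 2)
  have t1 := cosNum_add_prev (I := I) h (i + 1)
  simp only [add_one_one, add_one_two, add_two_one, add_two_two] at s2 t1
  have hq := mul_pos q1 q2
  have hs := Real.sqrt_pos.2 hq
  have hss := Real.sq_sqrt hq.le
  have hΔs := Real.sqrt_pos.2 hΔ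
  have ds := (dq1.mul dq2).sqrt hq.ne'
  have hlt : (cosNum ε (C t) (S t) I i
      / √(sinhSqSide ε (C t) (S t) I (i + 1) * sinhSqSide ε (C t) (S t) I (i + 2))) ^ 2 < 1 := by
    rw [div_pow, hss, div_lt_one hq]
    linarith
  have harc := Real.hasDerivAt_arccos (x := cosNum ε (C t) (S t) I i
      / √(sinhSqSide ε (C t) (S t) I (i + 1) * sinhSqSide ε (C t) (S t) I (i + 2)))
    (by rintro e; norm_num [e] at hlt) (by rintro e; norm_num [e] at hlt)
  have hsqrt : √(1 - (cosNum ε (C t) (S t) I i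
      / √(sinhSqSide ε (C t) (S t) I (i + 1) * sinhSqSide ε (C t) (S t) I (i + 2))) ^ 2)
      = √(areaSq ε (C t) (S t) I)
        / √(sinhSqSide ε (C t) (S t) I (i + 1) * sinhSqSide ε (C t) (S t) I (i + 2)) := by
    rw [← Real.sqrt_div hΔ.le, div_pow, hss, ← ha]
    congr 1
    field_simp
  rw [hsqrt] at harc
  refine (harc.comp t (dg.div ds hs.ne')).congr_deriv ?_
  simp only [angleVar, Pi.mul_apply]
  rw [hss]
  generalize √(sinhSqSide ε (C t) (S t) I (i + 1) * sinhSqSide ε (C t) (S t) I (i + 2)) = s at *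
  generalize √(areaSq ε (C t) (S t) I) = A at *
  generalize sinhSqSide ε (C t) (S t) I (i + 1) = q at *
  generalize sinhSqSide ε (C t) (S t) I (i + 2) = q' at *
  have e2 : cosNum ε (C t) (S t) I (i + 2) = coshSide ε (C t) (S t) I (i + 2) * q
    - cosNum ε (C t) (S t) I i * coshSide ε (C t) (S t) I (i + 1) := by linarith
  have e1 : cosNum ε (C t) (S t) I (i + 1) = coshSide ε (C t) (S t) I (i + 1) * q'
    - cosNum ε (C t) (S t) I i * coshSide ε (C t) (S t) I (i + 2) := by linarith
  rw [e1, e2]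
  field_simp
  rw [hss]
  ring

/-- The would-be cosine has absolute value at least `1`, and `arccos` clamps it. -/
theorem angle_eq_zero_or_pi (hε : 0 ≤ ε) {C S : Fin 3 → ℝ} (h : ∀ i, C i ^ 2 = 1 + ε * S i ^ 2)
    (hC : ∀ i, 0 < C i) (hS : ∀ i, 0 < S i) (hI : ∀ i, 0 ≤ I i)
    (hΔ : areaSq ε C S I ≤ 0) (i : Fin 3) :
    angle ε C S I i = 0 ∨ angle ε C S I i = Real.pi := by
  have q1 := sinhSqSide_pos hε hC hS hI (i + 1)
  have q2 := sinhSqSide_pos hε hC hS hI (i + 2)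
  have hs := Real.sqrt_pos.2 (mul_pos q1 q2)
  have hle : √(sinhSqSide ε C S I (i + 1) * sinhSqSide ε C S I (i + 2)) ≤ |cosNum ε C S I i| := by
    refine Real.sqrt_le_iff.2 ⟨abs_nonneg _, ?_⟩
    rw [sq_abs]
    linarith [areaSq_eq (I := I) h i]
  rcases le_abs.1 hle with h1 | h1
  · exact .inl (Real.arccos_of_one_le ((one_le_div hs).2 h1))
  · refine .inr (Real.arccos_of_le_neg_one ?_)
    rw [div_le_iff₀ hs]
    linarith

theorem hasDerivAt_sum_angle (hε : 0 ≤ ε) (h : ∀ i, C t i ^ 2 = 1 + ε * S t i ^ 2)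
    (hC0 : ∀ i, 0 < C t i) (hS0 : ∀ i, 0 < S t i) (hI : ∀ i, 0 ≤ I i)
    (hS : ∀ i, HasDerivAt (fun t => S t i) (C t i * S t i * w i) t)
    (hC : ∀ i, HasDerivAt (fun t => C t i) (ε * S t i ^ 2 * w i) t)
    (hΔ : 0 < areaSq ε (C t) (S t) I) :
    HasDerivAt (fun t => ∑ i, w i * angle ε (C t) (S t) I i)
      (-(form ε (C t) (S t) I w / √(areaSq ε (C t) (S t) I))) t := by
  refine (HasDerivAt.fun_sum (u := Finset.univ) fun i _ =>
    (hasDerivAt_angle hε h hC0 hS0 hI hS hC hΔ i).const_mul (w i)).congr_deriv ?_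
  rw [form, ← neg_div, neg_neg, Finset.sum_div]
  exact Finset.sum_congr rfl fun i _ => (mul_div_assoc _ _ _).symm

theorem continuousAt_sum_angle (hε : 0 ≤ ε) (h : ∀ i, C t i ^ 2 = 1 + ε * S t i ^ 2)
    (hC0 : ∀ i, 0 < C t i) (hS0 : ∀ i, 0 < S t i) (hI : ∀ i, 0 ≤ I i)
    (hS : ∀ i, HasDerivAt (fun t => S t i) (C t i * S t i * w i) t)
    (hC : ∀ i, HasDerivAt (fun t => C t i) (ε * S t i ^ 2 * w i) t) :
    ContinuousAt (fun t => ∑ i, w i * angle ε (C t) (S t) I i) t := by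
  refine tendsto_finsetSum _ fun i _ => ContinuousAt.mul continuousAt_const ?_
  have q1 := sinhSqSide_pos hε hC0 hS0 hI (i + 1)
  have q2 := sinhSqSide_pos hε hC0 hS0 hI (i + 2)
  have dq1 := (hasDerivAt_sinhSqSide (I := I) h hS hC (i + 1)).continuousAt
  have dq2 := (hasDerivAt_sinhSqSide (I := I) h hS hC (i + 2)).continuousAt
  have dg := (hasDerivAt_cosNum (I := I) h hS hC i).continuousAt
  exact Real.continuous_arccos.continuousAt.comp
    (dg.div (dq1.mul dq2).sqrt (Real.sqrt_pos.2 (mul_pos q1 q2)).ne')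

/-- Along a line in the space of conformal factors the angles, paired with the direction of the
line, do not increase. -/
theorem sum_angle_le (hε : 0 ≤ ε) {a b : ℝ} (hab : a ≤ b)
    (h : ∀ t ∈ Icc a b, ∀ i, C t i ^ 2 = 1 + ε * S t i ^ 2)
    (hC0 : ∀ t ∈ Icc a b, ∀ i, 0 < C t i) (hS0 : ∀ t ∈ Icc a b, ∀ i, 0 < S t i)
    (hI : ∀ i, 0 ≤ I i)
    (hS : ∀ t ∈ Icc a b, ∀ i, HasDerivAt (fun t => S t i) (C t i * S t i * w i) t)
    (hC : ∀ t ∈ Icc a b, ∀ i, HasDerivAt (fun t => C t i) (ε * S t i ^ 2 * w i) t) :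
    ∑ i, w i * angle ε (C b) (S b) I i ≤ ∑ i, w i * angle ε (C a) (S a) I i := by
  refine le_of_deriv_nonpos_off_finite (G := fun t => ∑ i, w i * angle ε (C t) (S t) I i) hab
    (fun t ht => (continuousAt_sum_angle hε (h t ht) (hC0 t ht) (hS0 t ht) hI (hS t ht)
      (hC t ht)).continuousWithinAt)
    -- The finitely many values that the sum can take on degenerate triangles.
    (finite_range fun f : Fin 3 → Bool => ∑ i, w i * (if f i then Real.pi else 0)) ?_
  intro t ht
  replace ht := Ioo_subset_Icc_self ht
  rcases le_or_gt (areaSq ε (C t) (S t) I) 0 with hΔ | hΔ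
  · left
    refine ⟨fun i => decide (angle ε (C t) (S t) I i = Real.pi), Finset.sum_congr rfl fun i _ => ?_⟩
    rcases angle_eq_zero_or_pi hε (h t ht) (hC0 t ht) (hS0 t ht) hI hΔ i with h0 | h0 <;>
      simp [h0, Real.pi_ne_zero.symm]
  · right
    refine ⟨_, ?_, hasDerivAt_sum_angle hε (h t ht) (hC0 t ht) (hS0 t ht) hI (hS t ht)
      (hC t ht) hΔ⟩
    have := form_nonneg (w := w) hε (h t ht) (hC0 t ht) (hS0 t ht) hI hΔ
    exact neg_nonpos.2 (by positivity)

/-- A positive form would make the sum drop strictly just after `a`, and by monotonicity it could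
not recover by `b`. -/
theorem form_eq_zero_of_sum_angle_eq (hε : 0 ≤ ε) {a b : ℝ} (hab : a < b)
    (h : ∀ t ∈ Icc a b, ∀ i, C t i ^ 2 = 1 + ε * S t i ^ 2)
    (hC0 : ∀ t ∈ Icc a b, ∀ i, 0 < C t i) (hS0 : ∀ t ∈ Icc a b, ∀ i, 0 < S t i)
    (hI : ∀ i, 0 ≤ I i)
    (hS : ∀ t ∈ Icc a b, ∀ i, HasDerivAt (fun t => S t i) (C t i * S t i * w i) t)
    (hC : ∀ t ∈ Icc a b, ∀ i, HasDerivAt (fun t => C t i) (ε * S t i ^ 2 * w i) t)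
    (hΔ : 0 < areaSq ε (C a) (S a) I)
    (heq : ∑ i, w i * angle ε (C b) (S b) I i = ∑ i, w i * angle ε (C a) (S a) I i) :
    form ε (C a) (S a) I w = 0 := by
  have ha := left_mem_Icc.2 hab.le
  have hnn := form_nonneg (w := w) hε (h a ha) (hC0 a ha) (hS0 a ha) hI hΔ
  by_contra hne
  have hpos := lt_of_le_of_ne hnn (Ne.symm hne)
  have hd := hasDerivAt_sum_angle hε (h a ha) (hC0 a ha) (hS0 a ha) hI (hS a ha) (hC a ha) hΔ
  have hneg : -(form ε (C a) (S a) I w / √(areaSq ε (C a) (S a) I)) < 0 :=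
    neg_neg_of_pos (div_pos hpos (Real.sqrt_pos.2 hΔ))
  have hev := ((hasDerivAt_iff_tendsto_slope.1 hd).mono_left
    (nhdsWithin_mono a (show Ioi a ⊆ {a}ᶜ from fun x hx => ne_of_gt hx))).eventually_lt_const hneg
  obtain ⟨t, hslope, ht⟩ := (hev.and (Ioo_mem_nhdsGT hab)).exists
  rw [slope_def_field, div_neg_iff] at hslope
  have hsub : Icc t b ⊆ Icc a b := Icc_subset_Icc_left ht.1.le
  have hle := sum_angle_le hε ht.2.le (fun s hs => h s (hsub hs)) (fun s hs => hC0 s (hsub hs))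
    (fun s hs => hS0 s (hsub hs)) hI (fun s hs => hS s (hsub hs)) (fun s hs => hC s (hsub hs))
  rcases hslope with h1 | h1
  · linarith [h1.2, ht.1]
  · linarith [h1.1]

end Deriv

end InversiveTriangle

/-! ### Passing between vertices and triangles -/

namespace SurfaceTriangulation

variable {F : Type*} {T : SurfaceTriangulation F}

/-- Grouping the corners by vertex turns the sum into `w` paired with the total angles, which the
curvature determines. -/
theorem sum_mul_angle_eq_of_curvature_eq [Fintype F] {angle : ℝ → ℝ → ℝ → ℝ} {l₁ l₂ : T.Edge → ℝ}
    (h : T.curvature angle l₁ = T.curvature angle l₂) (w : T.Vertex → ℝ) :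
    ∑ f, ∑ i, w (T.vertex (f, i)) * angle (l₁ (T.oppositeEdge f i))
        (l₁ (T.oppositeEdge f (i + 1))) (l₁ (T.oppositeEdge f (i + 2)))
      = ∑ f, ∑ i, w (T.vertex (f, i)) * angle (l₂ (T.oppositeEdge f i))
        (l₂ (T.oppositeEdge f (i + 1))) (l₂ (T.oppositeEdge f (i + 2))) := by
  classical
  have : Finite T.Vertex := inferInstanceAs (Finite (Quot _))
  have := Fintype.ofFinite T.Vertex
  have key (θ : F × Fin 3 → ℝ) : ∑ f, ∑ i, w (T.vertex (f, i)) * θ (f, i)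
      = ∑ v, w v * ∑ c with T.vertex c = v, θ c := by
    rw [← Fintype.sum_prod_type' (f := fun f i => w (T.vertex (f, i)) * θ (f, i)),
      ← Finset.sum_fiberwise _ T.vertex]
    refine Finset.sum_congr rfl fun v _ => ?_
    rw [Finset.mul_sum]
    refine Finset.sum_congr rfl fun c hc => ?_
    rw [← (Finset.mem_filter.1 hc).2]
  rw [key fun c => angle (l₁ (T.oppositeEdge c.1 c.2)) (l₁ (T.oppositeEdge c.1 (c.2 + 1)))
      (l₁ (T.oppositeEdge c.1 (c.2 + 2))),
    key fun c => angle (l₂ (T.oppositeEdge c.1 c.2)) (l₂ (T.oppositeEdge c.1 (c.2 + 1)))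
      (l₂ (T.oppositeEdge c.1 (c.2 + 2)))]
  refine Finset.sum_congr rfl fun v _ => ?_
  have hv := congrFun h v
  unfold curvature at hv
  congr 1
  convert sub_right_injective hv

theorem vertex_surjective : Function.Surjective T.vertex := Quot.mk_surjective

/-- On a connected surface a function on the vertices is constant if it is constant on each
triangle. -/
theorem IsConnected.eq_of_eq_on_faces (hT : T.IsConnected) {α : Type*} {w : T.Vertex → α}
    (hw : ∀ f i j, w (T.vertex (f, i)) = w (T.vertex (f, j))) (x y : T.Vertex) : w x = w y := by
  obtain ⟨⟨f, i⟩, rfl⟩ := vertex_surjective x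
  obtain ⟨⟨g, j⟩, rfl⟩ := vertex_surjective y
  have key : w (T.vertex (f, 0)) = w (T.vertex (g, 0)) := by
    induction hT.2 f g with
    | refl => rfl
    | tail _ hstep ih =>
      obtain ⟨d, rfl, rfl⟩ := hstep
      rw [ih, hw _ 0 d.src, ← T.vertex_src_glue d]
      exact hw _ _ _
  rw [hw f i 0, key, hw g 0 j]

end SurfaceTriangulation

namespace InversiveTriangle

/-- Equality in the monotonicity of the angles, summed over the faces. -/
theorem form_eq_zero_of_sum_eq {F : Type*} [Fintype F] {ε : ℝ} (hε : 0 ≤ ε)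
    {C S : F → ℝ → Fin 3 → ℝ} {I w : F → Fin 3 → ℝ}
    (h : ∀ f, ∀ t ∈ Set.Icc (0 : ℝ) 1, ∀ i, C f t i ^ 2 = 1 + ε * S f t i ^ 2)
    (hC0 : ∀ f, ∀ t ∈ Set.Icc (0 : ℝ) 1, ∀ i, 0 < C f t i)
    (hS0 : ∀ f, ∀ t ∈ Set.Icc (0 : ℝ) 1, ∀ i, 0 < S f t i) (hI : ∀ f i, 0 ≤ I f i)
    (hS : ∀ f, ∀ t ∈ Set.Icc (0 : ℝ) 1, ∀ i,
      HasDerivAt (fun t => S f t i) (C f t i * S f t i * w f i) t)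
    (hC : ∀ f, ∀ t ∈ Set.Icc (0 : ℝ) 1, ∀ i,
      HasDerivAt (fun t => C f t i) (ε * S f t i ^ 2 * w f i) t)
    (hΔ : ∀ f, 0 < areaSq ε (C f 0) (S f 0) (I f))
    (hsum : ∑ f, ∑ i, w f i * angle ε (C f 0) (S f 0) (I f) i
      = ∑ f, ∑ i, w f i * angle ε (C f 1) (S f 1) (I f) i) (f : F) :
    form ε (C f 0) (S f 0) (I f) (w f) = 0 := by
  refine form_eq_zero_of_sum_angle_eq hε zero_lt_one (h f) (hC0 f) (hS0 f) (hI f) (hS f) (hC f)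
    (hΔ f) ?_
  -- Every triangle contributes an inequality in the same direction, so equal totals force equality
  -- in each.
  exact (Finset.sum_eq_sum_iff_of_le fun f _ => sum_angle_le hε zero_le_one (h f) (hC0 f) (hS0 f)
    (hI f) (hS f) (hC f)).1 hsum.symm f (Finset.mem_univ f)

end InversiveTriangle

/-! ### Euclidean rigidity -/

namespace SurfaceTriangulation

open InversiveTriangle

variable {F : Type*} {T : SurfaceTriangulation F} {I : T.Edge → ℝ} {r : T.Vertex → ℝ}

section Euclidean

theorem euclideanLength_oppositeEdge (f : F) (i : Fin 3) :
    T.euclideanLength I r (T.oppositeEdge f i)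
      = √(sinhSqSide 0 1 (fun j => r (T.vertex (f, j))) (fun j => I (T.oppositeEdge f j)) i) := by
  change √_ = _
  simp only [sinhSqSide, Pi.one_apply]
  congr 1
  simp only [oppositeEdge]
  ring

theorem euclideanTriangleAngle_eq (hr : ∀ v, 0 < r v) (hI : ∀ e, 0 ≤ I e) (f : F) (i : Fin 3) :
    euclideanTriangleAngle (T.euclideanLength I r (T.oppositeEdge f i))
      (T.euclideanLength I r (T.oppositeEdge f (i + 1)))
      (T.euclideanLength I r (T.oppositeEdge f (i + 2)))
      = angle 0 1 (fun j => r (T.vertex (f, j))) (fun j => I (T.oppositeEdge f j)) i := by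
  have q (i) := sinhSqSide_pos (C := 1) (S := fun j => r (T.vertex (f, j)))
    (I := fun j => I (T.oppositeEdge f j)) le_rfl (fun _ => zero_lt_one) (fun j => hr _)
    (fun j => hI _) i
  simp only [euclideanTriangleAngle, angle, euclideanLength_oppositeEdge, Real.sq_sqrt (q _).le]
  rw [Real.sqrt_mul (q _).le, mul_assoc]
  congr 1
  rw [← div_div]
  congr 1
  simp only [sinhSqSide, cosNum, Pi.one_apply, add_one_one, add_one_two, add_two_one, add_two_two]
  ring

theorem IsEuclideanCirclePacking.areaSq_pos (h : T.IsEuclideanCirclePacking I r)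
    (hI : ∀ e, 0 ≤ I e) (f : F) :
    0 < areaSq 0 1 (fun j => r (T.vertex (f, j))) (fun j => I (T.oppositeEdge f j)) := by
  have q (i) := sinhSqSide_pos (C := 1) (S := fun j => r (T.vertex (f, j)))
    (I := fun j => I (T.oppositeEdge f j)) le_rfl (fun _ => zero_lt_one) (fun j => h.1 _)
    (fun j => hI _) i
  have h0 := h.2 f 1 2 0 (by decide) (by decide) (by decide)
  have h1 := h.2 f 2 0 1 (by decide) (by decide) (by decide)
  have h2 := h.2 f 0 1 2 (by decide) (by decide) (by decide)
  simp only [euclideanLength_oppositeEdge] at h0 h1 h2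
  have s0 := Real.sq_sqrt (q 0).le
  have s1 := Real.sq_sqrt (q 1).le
  have s2 := Real.sq_sqrt (q 2).le
  have p0 := Real.sqrt_pos.2 (q 0)
  have p1 := Real.sqrt_pos.2 (q 1)
  have p2 := Real.sqrt_pos.2 (q 2)
  have hg : 2 * cosNum 0 1 (fun j => r (T.vertex (f, j))) (fun j => I (T.oppositeEdge f j)) 0
      = sinhSqSide 0 1 (fun j => r (T.vertex (f, j))) (fun j => I (T.oppositeEdge f j)) 1
      + sinhSqSide 0 1 (fun j => r (T.vertex (f, j))) (fun j => I (T.oppositeEdge f j)) 2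
      - sinhSqSide 0 1 (fun j => r (T.vertex (f, j))) (fun j => I (T.oppositeEdge f j)) 0 := by
    simp [sinhSqSide, cosNum]
    ring
  unfold areaSq
  generalize sinhSqSide 0 1 (fun j => r (T.vertex (f, j))) (fun j => I (T.oppositeEdge f j)) 0 = x
    at *
  generalize sinhSqSide 0 1 (fun j => r (T.vertex (f, j))) (fun j => I (T.oppositeEdge f j)) 1 = y
    at *
  generalize sinhSqSide 0 1 (fun j => r (T.vertex (f, j))) (fun j => I (T.oppositeEdge f j)) 2 = z
    at *
  generalize cosNum 0 1 (fun j => r (T.vertex (f, j))) (fun j => I (T.oppositeEdge f j)) 0 = g at *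
  -- Heron's formula: this product is four times `areaSq`.
  have hprod : 0 < (√x + √y + √z) * (√y + √z - √x) * ((√x + √z - √y) * (√x + √y - √z)) :=
    mul_pos (mul_pos (by linarith) (by linarith)) (mul_pos (by linarith) (by linarith))
  have e : (√x + √y + √z) * (√y + √z - √x) * ((√x + √z - √y) * (√x + √y - √z))
      = 4 * (√y ^ 2 * √z ^ 2) - (√y ^ 2 + √z ^ 2 - √x ^ 2) ^ 2 := by ring
  rw [e, s0, s1, s2, ← hg] at hprod
  linarith

theorem euclidean_rigidity [Fintype F] (hT : T.IsConnected) (hI : ∀ e, 0 ≤ I e)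
    {r₁ r₂ : T.Vertex → ℝ} (h₁ : T.IsEuclideanCirclePacking I r₁)
    (h₂ : T.IsEuclideanCirclePacking I r₂)
    (hk : T.euclideanCurvature (T.euclideanLength I r₁)
      = T.euclideanCurvature (T.euclideanLength I r₂)) :
    ∃ c : ℝ, 0 < c ∧ r₂ = c • r₁ ∧ T.euclideanLength I r₂ = c • T.euclideanLength I r₁ := by
  -- The difference of the conformal factors `log r`; the segment between them is `r₁ * exp (t *
  -- w)`.
  set w : T.Vertex → ℝ := fun v => Real.log (r₂ v / r₁ v) with hw
  have hexp (v) : r₁ v * Real.exp (w v) = r₂ v := by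
    rw [Real.exp_log (div_pos (h₂.1 v) (h₁.1 v)), mul_div_cancel₀ _ (h₁.1 v).ne']
  have hsum := sum_mul_angle_eq_of_curvature_eq hk w
  simp only [euclideanTriangleAngle_eq h₁.1 hI, euclideanTriangleAngle_eq h₂.1 hI] at hsum
  have hform := form_eq_zero_of_sum_eq (ε := 0) le_rfl (C := fun _ _ => (1 : Fin 3 → ℝ))
    (S := fun f t j => r₁ (T.vertex (f, j)) * Real.exp (t * w (T.vertex (f, j))))
    (I := fun f j => I (T.oppositeEdge f j)) (w := fun f j => w (T.vertex (f, j)))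
    (by simp) (by simp) (fun f t _ j => mul_pos (h₁.1 _) (Real.exp_pos _)) (fun f j => hI _)
    (fun f t _ j => (((hasDerivAt_mul_const (w (T.vertex (f, j)))).exp).const_mul
      (r₁ (T.vertex (f, j)))).congr_deriv (by simp; ring))
    (fun f t _ j => (hasDerivAt_const t (1 : ℝ)).congr_deriv (by simp))
    (fun f => by simpa using h₁.areaSq_pos hI f) (by simpa [hexp] using hsum)
  have hconst := hT.eq_of_eq_on_faces (w := w) fun f i j =>
    eq_of_form_eq_zero (C := 1) (w := fun j => w (T.vertex (f, j))) (fun _ => rfl) (fun j => h₁.1 _)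
      (fun j => hI _) (h₁.areaSq_pos hI f) (by simpa using hform f) i j
  obtain ⟨f⟩ := hT.1
  have hr : r₂ = Real.exp (w (T.vertex (f, 0))) • r₁ := by
    ext v
    rw [Pi.smul_apply, smul_eq_mul, mul_comm, ← hconst v, hexp]
  refine ⟨_, Real.exp_pos _, hr, ?_⟩
  rw [hr]
  have hc := Real.exp_pos (w (T.vertex (f, 0)))
  generalize Real.exp (w (T.vertex (f, 0))) = c at *
  ext e
  obtain ⟨d, rfl⟩ := Quot.mk_surjective e
  change √((c * _) ^ 2 + (c * _) ^ 2 + 2 * (c * _) * (c * _) * _) = c * √_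
  rw [← Real.sqrt_sq hc.le, ← Real.sqrt_mul (sq_nonneg _), Real.sqrt_sq hc.le]
  congr 1
  ring

end Euclidean

end SurfaceTriangulation

/-! ### Hyperbolic rigidity -/

namespace SurfaceTriangulation

open InversiveTriangle

variable {F : Type*} {T : SurfaceTriangulation F} {I : T.Edge → ℝ} {r : T.Vertex → ℝ}

section Hyperbolic

/-- The hyperbolic conformal factor `log (tanh (r / 2))`, in a form convenient for computing the
hyperbolic functions of `r`. -/
noncomputable def hyperbolicFactor (r : ℝ) : ℝ := -Real.arsinh (Real.sinh r)⁻¹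

theorem hyperbolicFactor_neg {r : ℝ} (hr : 0 < r) : hyperbolicFactor r < 0 :=
  neg_neg_of_pos (Real.arsinh_pos_iff.2 (inv_pos.2 (Real.sinh_pos_iff.2 hr)))

theorem sinh_hyperbolicFactor (r : ℝ) : Real.sinh (hyperbolicFactor r) = -(Real.sinh r)⁻¹ := by
  rw [hyperbolicFactor, Real.sinh_neg, Real.sinh_arsinh]

theorem cosh_hyperbolicFactor {r : ℝ} (hr : 0 < r) :
    Real.cosh (hyperbolicFactor r) = Real.cosh r / Real.sinh r := by
  have hs := Real.sinh_pos_iff.2 hr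
  rw [hyperbolicFactor, Real.cosh_neg, Real.cosh_arsinh, Real.sqrt_eq_iff_eq_sq (by positivity)
    (div_nonneg (Real.cosh_pos r).le hs.le), div_pow, Real.cosh_sq]
  field_simp

theorem hyperbolicFactor_injective : Function.Injective hyperbolicFactor := fun _ _ h =>
  Real.sinh_injective (inv_injective (Real.arsinh_injective (neg_injective h)))

theorem hyperbolicLength_oppositeEdge (f : F) (i : Fin 3) :
    T.hyperbolicLength I r (T.oppositeEdge f i)
      = Real.arcosh (coshSide 1 (fun j => Real.cosh (r (T.vertex (f, j))))
        (fun j => Real.sinh (r (T.vertex (f, j)))) (fun j => I (T.oppositeEdge f j)) i) := by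
  change Real.arcosh _ = _
  simp only [coshSide, one_mul]

theorem one_le_coshSide (hr : ∀ v, 0 < r v) (hI : ∀ e, 0 ≤ I e) (f : F) (i : Fin 3) :
    1 ≤ coshSide 1 (fun j => Real.cosh (r (T.vertex (f, j))))
        (fun j => Real.sinh (r (T.vertex (f, j)))) (fun j => I (T.oppositeEdge f j)) i := by
  have h1 := Real.sinh_pos_iff.2 (hr (T.vertex (f, i + 1)))
  have h2 := Real.sinh_pos_iff.2 (hr (T.vertex (f, i + 2)))
  have h3 := mul_nonneg (mul_nonneg (hI (T.oppositeEdge f i)) h1.le) h2.le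
  have h4 := one_le_mul_of_one_le_of_one_le (Real.one_le_cosh (r (T.vertex (f, i + 1))))
    (Real.one_le_cosh (r (T.vertex (f, i + 2))))
  simp only [coshSide, one_mul]
  linarith

theorem cosh_hyperbolicLength (hr : ∀ v, 0 < r v) (hI : ∀ e, 0 ≤ I e) (f : F) (i : Fin 3) :
    Real.cosh (T.hyperbolicLength I r (T.oppositeEdge f i))
      = coshSide 1 (fun j => Real.cosh (r (T.vertex (f, j))))
        (fun j => Real.sinh (r (T.vertex (f, j)))) (fun j => I (T.oppositeEdge f j)) i := by
  rw [hyperbolicLength_oppositeEdge, Real.cosh_arcosh (one_le_coshSide hr hI f i)]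

theorem cosh_sq_eq (f : F) (j : Fin 3) : Real.cosh (r (T.vertex (f, j))) ^ 2
    = 1 + 1 * Real.sinh (r (T.vertex (f, j))) ^ 2 := by
  rw [Real.cosh_sq]; ring

theorem sinh_hyperbolicLength (hr : ∀ v, 0 < r v) (hI : ∀ e, 0 ≤ I e) (f : F) (i : Fin 3) :
    Real.sinh (T.hyperbolicLength I r (T.oppositeEdge f i))
      = √(sinhSqSide 1 (fun j => Real.cosh (r (T.vertex (f, j))))
        (fun j => Real.sinh (r (T.vertex (f, j)))) (fun j => I (T.oppositeEdge f j)) i) := by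
  rw [hyperbolicLength_oppositeEdge, Real.sinh_arcosh (one_le_coshSide hr hI f i),
    coshSide_sq (cosh_sq_eq f)]
  ring_nf

/-- The hyperbolic law of cosines in polynomial form. -/
theorem cosNum_eq_coshSide {C S I : Fin 3 → ℝ} (h : ∀ i, C i ^ 2 = 1 + 1 * S i ^ 2) (i : Fin 3) :
    cosNum 1 C S I i
      = coshSide 1 C S I (i + 1) * coshSide 1 C S I (i + 2) - coshSide 1 C S I i := by
  have h0 := h i
  simp only [cosNum, coshSide, add_one_one, add_one_two, add_two_one, add_two_two]
  linear_combination (-C (i + 1) * C (i + 2)) * h0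

theorem hyperbolicTriangleAngle_eq (hr : ∀ v, 0 < r v) (hI : ∀ e, 0 ≤ I e) (f : F) (i : Fin 3) :
    hyperbolicTriangleAngle (T.hyperbolicLength I r (T.oppositeEdge f i))
      (T.hyperbolicLength I r (T.oppositeEdge f (i + 1)))
      (T.hyperbolicLength I r (T.oppositeEdge f (i + 2)))
      = angle 1 (fun j => Real.cosh (r (T.vertex (f, j))))
        (fun j => Real.sinh (r (T.vertex (f, j)))) (fun j => I (T.oppositeEdge f j)) i := by
  have q := sinhSqSide_pos (ε := 1) (C := fun j => Real.cosh (r (T.vertex (f, j))))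
    (S := fun j => Real.sinh (r (T.vertex (f, j)))) (I := fun j => I (T.oppositeEdge f j))
    zero_le_one (fun _ => Real.cosh_pos _) (fun j => Real.sinh_pos_iff.2 (hr _)) (fun j => hI _)
    (i + 1)
  simp only [hyperbolicTriangleAngle, angle, cosh_hyperbolicLength hr hI,
    sinh_hyperbolicLength hr hI, cosNum_eq_coshSide (cosh_sq_eq f), Real.sqrt_mul q.le]

theorem IsHyperbolicCirclePacking.areaSq_pos (h : T.IsHyperbolicCirclePacking I r)
    (hI : ∀ e, 0 ≤ I e) (f : F) :
    0 < areaSq 1 (fun j => Real.cosh (r (T.vertex (f, j))))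
        (fun j => Real.sinh (r (T.vertex (f, j)))) (fun j => I (T.oppositeEdge f j)) := by
  have q (i) := sinhSqSide_pos (ε := 1) (C := fun j => Real.cosh (r (T.vertex (f, j))))
    (S := fun j => Real.sinh (r (T.vertex (f, j)))) (I := fun j => I (T.oppositeEdge f j))
    zero_le_one (fun _ => Real.cosh_pos _) (fun j => Real.sinh_pos_iff.2 (h.1 _)) (fun j => hI _)
    i
  have h0 := h.2 f 1 2 0 (by decide) (by decide) (by decide)
  have h1 := h.2 f 2 0 1 (by decide) (by decide) (by decide)
  have h2 := h.2 f 0 1 2 (by decide) (by decide) (by decide)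
  have hl : 0 ≤ T.hyperbolicLength I r (T.oppositeEdge f 0) := by
    rw [hyperbolicLength_oppositeEdge]
    exact Real.arcosh_nonneg (one_le_coshSide h.1 hI f 0)
  rw [areaSq, cosNum_eq_coshSide (cosh_sq_eq f), ← Real.sq_sqrt (q 1).le,
    ← Real.sq_sqrt (q 2).le, ← sinh_hyperbolicLength h.1 hI, ← sinh_hyperbolicLength h.1 hI,
    ← cosh_hyperbolicLength h.1 hI, ← cosh_hyperbolicLength h.1 hI,
    ← cosh_hyperbolicLength h.1 hI, zero_add, zero_add]
  generalize T.hyperbolicLength I r (T.oppositeEdge f 0) = a at *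
  generalize T.hyperbolicLength I r (T.oppositeEdge f 1) = b at *
  generalize T.hyperbolicLength I r (T.oppositeEdge f 2) = c at *
  -- The addition formulas factor `areaSq` as `(cosh (b + c) - cosh a) * (cosh a - cosh (b - c))`;
  -- the triangle inequalities make both factors positive.
  have k1 : Real.cosh a < Real.cosh (b + c) := by
    rw [Real.cosh_lt_cosh, abs_of_nonneg hl]
    exact h0.trans_le (le_abs_self _)
  have k2 : Real.cosh (b - c) < Real.cosh a := by
    rw [Real.cosh_lt_cosh, abs_of_nonneg hl, abs_lt]
    constructor <;> linarith
  have := mul_pos (sub_pos.2 k1) (sub_pos.2 k2)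
  rw [Real.cosh_add, Real.cosh_sub] at this
  linarith

theorem hyperbolic_rigidity [Fintype F] (hI : ∀ e, 0 ≤ I e)
    {r₁ r₂ : T.Vertex → ℝ} (h₁ : T.IsHyperbolicCirclePacking I r₁)
    (h₂ : T.IsHyperbolicCirclePacking I r₂)
    (hk : T.hyperbolicCurvature (T.hyperbolicLength I r₁)
      = T.hyperbolicCurvature (T.hyperbolicLength I r₂)) : r₁ = r₂ := by
  set u : T.Vertex → ℝ → ℝ := fun v t => hyperbolicFactor (r₁ v)
    + t * (hyperbolicFactor (r₂ v) - hyperbolicFactor (r₁ v)) with hu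
  have hu0 (v) : u v 0 = hyperbolicFactor (r₁ v) := by simp [hu]
  have hu1 (v) : u v 1 = hyperbolicFactor (r₂ v) := by simp [hu]
  -- The range of the conformal factor is the convex set of negative numbers, so `-1 / sinh u` and
  -- `-coth u`, the `sinh` and `cosh` of the interpolated radius, stay positive along the segment.
  have hneg (v) : ∀ t ∈ Set.Icc (0 : ℝ) 1, Real.sinh (u v t) < 0 := by
    intro t ht
    refine Real.sinh_neg_iff.2 ?_
    have n1 := hyperbolicFactor_neg (h₁.1 v)
    have n2 := hyperbolicFactor_neg (h₂.1 v)
    simp only [hu]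
    rcases ht.1.eq_or_lt with rfl | h0
    · simpa using n1
    · nlinarith [mul_neg_of_pos_of_neg h0 n2, mul_nonneg (sub_nonneg.2 ht.2) (neg_pos.2 n1).le]
  have hder (v t) : HasDerivAt (u v) (hyperbolicFactor (r₂ v) - hyperbolicFactor (r₁ v)) t :=
    (hasDerivAt_mul_const _).const_add _
  have hsinh {r : ℝ} : -(Real.sinh (hyperbolicFactor r))⁻¹ = Real.sinh r := by
    rw [sinh_hyperbolicFactor, inv_neg, neg_neg, inv_inv]
  have hcosh {r : ℝ} (hr : 0 < r) : -(Real.cosh (hyperbolicFactor r)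
      / Real.sinh (hyperbolicFactor r)) = Real.cosh r := by
    have := (Real.sinh_pos_iff.2 hr).ne'
    rw [sinh_hyperbolicFactor, cosh_hyperbolicFactor hr]
    field_simp
  have hsum := sum_mul_angle_eq_of_curvature_eq hk
    fun v => hyperbolicFactor (r₂ v) - hyperbolicFactor (r₁ v)
  simp only [hyperbolicTriangleAngle_eq h₁.1 hI, hyperbolicTriangleAngle_eq h₂.1 hI] at hsum
  have hform := form_eq_zero_of_sum_eq (ε := 1) zero_le_one
    (C := fun f t j => -(Real.cosh (u (T.vertex (f, j)) t) / Real.sinh (u (T.vertex (f, j)) t)))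
    (S := fun f t j => -(Real.sinh (u (T.vertex (f, j)) t))⁻¹)
    (I := fun f j => I (T.oppositeEdge f j))
    (w := fun f j => hyperbolicFactor (r₂ (T.vertex (f, j)))
      - hyperbolicFactor (r₁ (T.vertex (f, j))))
    (fun f t ht j => by
      have := (hneg (T.vertex (f, j)) t ht).ne
      rw [neg_sq, div_pow, Real.cosh_sq]
      field_simp)
    (fun f t ht j => neg_pos.2 (div_neg_of_pos_of_neg (Real.cosh_pos _) (hneg _ t ht)))
    (fun f t ht j => neg_pos.2 (inv_lt_zero.2 (hneg _ t ht))) (fun f j => hI _)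
    (fun f t ht j => by
      have := (hneg (T.vertex (f, j)) t ht).ne
      refine ((hder (T.vertex (f, j)) t).sinh.inv this).neg.congr_deriv ?_
      field_simp)
    (fun f t ht j => by
      have := (hneg (T.vertex (f, j)) t ht).ne
      refine ((hder (T.vertex (f, j)) t).cosh.div (hder (T.vertex (f, j)) t).sinh this).neg
        |>.congr_deriv ?_
      field_simp
      rw [Real.cosh_sq]
      ring)
    (fun f => by simpa only [hu0, hsinh, hcosh (h₁.1 _)] using h₁.areaSq_pos hI f)
    (by simpa only [hu0, hu1, hsinh, hcosh (h₁.1 _), hcosh (h₂.1 _)] using hsum)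
  simp only [hu0, hsinh, hcosh (h₁.1 _)] at hform
  ext v
  obtain ⟨⟨f, j⟩, rfl⟩ := vertex_surjective v
  have := eq_zero_of_form_eq_zero zero_lt_one (cosh_sq_eq f) (fun j => Real.cosh_pos _)
    (fun j => Real.sinh_pos_iff.2 (h₁.1 _)) (fun j => hI _) (h₁.areaSq_pos hI f) (hform f) j
  exact hyperbolicFactor_injective (sub_eq_zero.1 this).symm

end Hyperbolic

end SurfaceTriangulation

theorem theorem1p4 {F : Type*} [Fintype F] (T : SurfaceTriangulation F) (hT : T.IsConnected)
    (I : T.Edge → ℝ) (hI : ∀ e, 0 ≤ I e) :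
    (∀ r₁ r₂ : T.Vertex → ℝ,
      T.IsHyperbolicCirclePacking I r₁ → T.IsHyperbolicCirclePacking I r₂ →
      T.hyperbolicCurvature (T.hyperbolicLength I r₁) =
        T.hyperbolicCurvature (T.hyperbolicLength I r₂) →
      r₁ = r₂ ∧ T.hyperbolicLength I r₁ = T.hyperbolicLength I r₂) ∧
    (∀ r₁ r₂ : T.Vertex → ℝ,
      T.IsEuclideanCirclePacking I r₁ → T.IsEuclideanCirclePacking I r₂ →
      T.euclideanCurvature (T.euclideanLength I r₁) =
        T.euclideanCurvature (T.euclideanLength I r₂) →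
      ∃ c : ℝ, 0 < c ∧ r₂ = c • r₁ ∧ T.euclideanLength I r₂ = c • T.euclideanLength I r₁) := by
  refine ⟨fun r₁ r₂ h₁ h₂ hk => ?_, fun r₁ r₂ h₁ h₂ hk => SurfaceTriangulation.euclidean_rigidity hT hI h₁ h₂ hk⟩
  have h := SurfaceTriangulation.hyperbolic_rigidity hI h₁ h₂ hk
  exact ⟨h, by rw [h]⟩
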